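/- Let $K$ be a field and let $n_1,\dots,n_4$ be positive integers with $\gcd(n_1,\dots,n_4)=1$ that minimally generate the numerical semigroup $S=\langle n_1,\dots,n_4\rangle$. Put $PF(S)=\{x\in\mathbb Z\setminus S : x+s\in S \text{ for all } s\in S\setminus\{0\}\}$ and assume that $S$ is pseudo-symmetric, i.e. $PF(S)=\{g/2,g\}$ with $g=\max PF(S)$. Let $\alpha_1,\alpha_2,\alpha_3,\alpha_4>1$ and $0<\alpha_{21}<\alpha_1$ be integers with \begin{align*} n_1&=\alpha_2\alpha_3(\alpha_4-1)+1,\\ n_2&=\alpha_{21}\alpha_3\alpha_4+(\alpha_1-\alpha_{21}-1)(\alpha_3-1)+\alpha_3,\\ n_3&=\alpha_1\alpha_4+(\alpha_1-\alpha_{21}-1)(\alpha_2-1)(\alpha_4-1)-\alpha_4+1,\\ n_4&=\alpha_1\alpha_2(\alpha_3-1)+\alpha_{21}(\alpha_2-1)+\alpha_2 \end{align*} (by a theorem of Komeda such integers exist for every 4-generated pseudo-symmetric numerical semigroup, after renumbering the generators). Let $A=K[X_1,\dots,X_4]$ be graded by $\deg X_i=n_i$, and regard $K[S]=K[t^{n_1},\dots,t^{n_4}]$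 as a graded $A$-module through $X_i\mapsto t^{n_i}$. A minimal graded free resolution $(\mathbf F,\phi)$ of $K[S]$ over $A$, given with homogeneous bases of its free modules, is called strongly indispensable if for every minimal graded free resolution $(\mathbf G,\theta)$ of $K[S]$ with homogeneous bases there is an injective map of graded complexes $\mathbf F\to\mathbf G$ that sends each basis element of $\mathbf F$ to a nonzero scalar multiple of a basis element of $\mathbf G$. Then $K[S]$ has a strongly indispensable minimal graded free resolution if and only if $\alpha_4>2$ and $\alpha_1-\alpha_{21}>2$. -/

import Mathlib

open MvPolynomial

noncomputable section

/-- The numerical semigroup `⟨n₁, n₂, n₃, n₄⟩ = {u₁ n₁ + ⋯ + u₄ n₄ | uᵢ ∈ ℕ}`. -/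
def numSemigroup (n : Fin 4 → ℕ) : AddSubmonoid ℕ :=
  AddSubmonoid.closure (Set.range n)

/-- `n₁, …, n₄` are positive, have greatest common divisor `1`, and form a minimal generating
system of the semigroup they generate. -/
structure IsMinimalGenerators (n : Fin 4 → ℕ) : Prop where
  pos : ∀ i, 0 < n i
  gcd_eq_one : Finset.univ.gcd n = 1
  minimal : ∀ i, n i ∉ AddSubmonoid.closure (n '' {j | j ≠ i})

/-- Pseudo-Frobenius numbers: `x ∈ ℤ ∖ S` with `x + s ∈ S` for all `s ∈ S ∖ {0}`. -/
def pseudoFrobenius (S : AddSubmonoid ℕ) : Set ℤ :=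
  {x | (∀ t ∈ S, x ≠ (t : ℤ)) ∧ ∀ s ∈ S, s ≠ 0 → ∃ t ∈ S, x + (s : ℤ) = (t : ℤ)}

/-- `S` is pseudo-symmetric: `PF(S) = {g / 2, g}`, where `g = 2 h` is the Frobenius number,
i.e. the largest pseudo-Frobenius number. -/
def IsPseudoSymmetric (S : AddSubmonoid ℕ) : Prop :=
  ∃ h : ℤ, IsGreatest (pseudoFrobenius S) (2 * h) ∧ pseudoFrobenius S = {h, 2 * h}

/-- The map `K[X₁, …, X₄] → K[t]`, `Xᵢ ↦ t ^ nᵢ`. -/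
def toricMap (K : Type*) [Field K] (n : Fin 4 → ℕ) :
    MvPolynomial (Fin 4) K →ₐ[K] Polynomial K :=
  aeval fun i => Polynomial.X ^ n i

/-- The semigroup ring `K[S] = K[t ^ n₁, …, t ^ n₄]`. -/
def semigroupRing (K : Type*) [Field K] (n : Fin 4 → ℕ) : Subalgebra K (Polynomial K) :=
  (toricMap K n).range

/-- `K[S]` as a module over `A = K[X₁, …, X₄]` through `Xᵢ ↦ t ^ nᵢ`. -/
instance semigroupRingModule (K : Type*) [Field K] (n : Fin 4 → ℕ) :
    Module (MvPolynomial (Fin 4) K) (semigroupRing K n) :=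
  Module.compHom (toricMap K n).range (toricMap K n).rangeRestrict.toRingHom

/-- For the graded free module `⨁ₖ A[-deg k]`, whose `k`-th basis element has degree `deg k`:
the element `v` is homogeneous of degree `e` (where `Xᵢ` has degree `nᵢ`). -/
def IsHomogeneousVec {K : Type*} [Field K] (n : Fin 4 → ℕ) {r : ℕ} (deg : Fin r → ℕ)
    (v : Fin r → MvPolynomial (Fin 4) K) (e : ℕ) : Prop :=
  ∀ k, ∀ u ∈ (v k).support, Finsupp.weight n u + deg k = e

/-- A minimal graded free resolution
`⋯ → ⨁ⱼ A[-deg 1 j] → ⨁ⱼ A[-deg 0 j] → K[S] → 0` of `K[S]` over `A = K[X₁, …, X₄]`,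
together with homogeneous bases (the standard ones) of its free modules. -/
structure MinimalGradedResolution (K : Type*) [Field K] (n : Fin 4 → ℕ) where
  /-- the rank of the free module in homological degree `i` -/
  rank : ℕ → ℕ
  /-- the degrees of the basis elements in homological degree `i` -/
  deg : ∀ i, Fin (rank i) → ℕ
  /-- the differentials -/
  d : ∀ i, (Fin (rank (i + 1)) → MvPolynomial (Fin 4) K) →ₗ[MvPolynomial (Fin 4) K]
    (Fin (rank i) → MvPolynomial (Fin 4) K)
  /-- the augmentation -/
  aug : (Fin (rank 0) → MvPolynomial (Fin 4) K) →ₗ[MvPolynomial (Fin 4) K] semigroupRing K n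
  /-- the differentials preserve degrees -/
  d_homogeneous : ∀ i j, IsHomogeneousVec n (deg i) (d i (Pi.single j 1)) (deg (i + 1) j)
  /-- the augmentation preserves degrees -/
  aug_homogeneous : ∀ j, ∃ c : K,
    (aug (Pi.single j 1) : Polynomial K) = Polynomial.monomial (deg 0 j) c
  aug_surjective : Function.Surjective aug
  exact_zero : Function.Exact (d 0) aug
  exact_succ : ∀ i, Function.Exact (d (i + 1)) (d i)
  /-- minimality: the image of each differential lies in `(X₁, …, X₄)` times its target -/
  minimal : ∀ i j k, constantCoeff (d i (Pi.single j 1) k) = 0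

/-- `F` is strongly indispensable: for every minimal graded free resolution `G` of `K[S]` with
homogeneous bases there is an injective map of graded complexes `F → G` which sends every basis
element of `F` to a nonzero scalar multiple of a basis element of `G` (of the same degree). -/
def MinimalGradedResolution.StronglyIndispensable {K : Type*} [Field K] {n : Fin 4 → ℕ}
    (F : MinimalGradedResolution K n) : Prop :=
  ∀ G : MinimalGradedResolution K n,
    ∃ f : ∀ i, (Fin (F.rank i) → MvPolynomial (Fin 4) K) →ₗ[MvPolynomial (Fin 4) K]
        (Fin (G.rank i) → MvPolynomial (Fin 4) K),
      (∀ i, f i ∘ₗ F.d i = G.d i ∘ₗ f (i + 1)) ∧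
      (∀ i, Function.Injective (f i)) ∧
      ∀ i j, ∃ k, ∃ c : K, c ≠ 0 ∧ G.deg i k = F.deg i j ∧
        f i (Pi.single j 1) = Pi.single k (C c)

end

/-!
With `p = α₂₁`, `q = α₁ - α₂₁ - 1`, `a = α₂ - 1`, `b = α₃ - 1` and `c = α₄ - 1`, the ideal of
`K[S]` is generated by five binomials. Each has a term free of `X₀`, and there are only
`n 0 = (a + 1) * (b + 1) * c + 1` monomials free of `X₀` that none of these terms divides, one for
each residue modulo `n 0`; so no further generator is needed. The minimal resolution has Betti
numbers `1, 5, 6, 2`: since everything is graded, its exactness can be checked modulo `X₀`, where it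
comes down to Koszul relations between powers of three variables.

Suppose that in each homological degree no two basis degrees of a resolution differ by an element
of the semigroup. Then any comparison map to another minimal resolution takes basis elements to
multiples of basis elements, and strong indispensability follows. Conversely, if the degrees of
`e j` and `e k` differ by the weight of `u`, replacing `e j` by `e j + X ^ u • e k` gives a
resolution that obstructs strong indispensability. Two degrees `d ≠ e` are separated by writing
`d - e` as a difference of weights of two monomials neither of which is divisible by a term of the
five binomials. This succeeds if and only if `2 ≤ c` and `2 ≤ q`: for `c = 1` two degrees of first
syzygies differ by `p * n 0`, and for `q = 1` two degrees of generators differ by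
`(a - 1) * n 1 + b * n 2`.
-/

/-! ### Graded free modules over a weighted polynomial ring -/

section GradedModule

variable {σ ι κ R : Type*} [CommRing R] {w : σ → ℕ} {deg : ι → ℕ} {s : Set ℕ}

/-- For the graded free module whose `k`-th basis element has degree `deg k`, over the polynomial
ring with `X i` of degree `w i`: the elements all of whose terms have degree in `s`. -/
noncomputable def degreeSupported (w : σ → ℕ) (deg : ι → ℕ) (s : Set ℕ) :
    Submodule R (ι → MvPolynomial σ R) :=
  Submodule.pi Set.univ fun k => restrictSupport R {u | Finsupp.weight w u + deg k ∈ s}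

theorem mem_degreeSupported {v : ι → MvPolynomial σ R} :
    v ∈ degreeSupported w deg s ↔
      ∀ k, ∀ u, coeff u (v k) ≠ 0 → Finsupp.weight w u + deg k ∈ s := by
  simp only [degreeSupported, Submodule.mem_pi, Set.mem_univ, true_imp_iff,
    mem_restrictSupport_iff, Set.subset_def, SetLike.mem_coe, mem_support_iff, Set.mem_ofPred_eq]

theorem single_monomial_mem_degreeSupported [DecidableEq ι] {u : σ →₀ ℕ} {k : ι} (c : R)
    (h : Finsupp.weight w u + deg k ∈ s) :
    Pi.single k (monomial u c) ∈ degreeSupported w deg s :=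
  Submodule.mem_pi.2 fun l _ => by
    obtain rfl | hlk := eq_or_ne l k
    · rw [Pi.single_eq_same]
      exact (monomial_mem_restrictSupport R).2 (Or.inl h)
    · rw [Pi.single_eq_of_ne hlk]
      exact zero_mem _

theorem single_one_mem_degreeSupported [DecidableEq ι] (k : ι) :
    (Pi.single k 1 : ι → MvPolynomial σ R) ∈ degreeSupported w deg {deg k} :=
  single_monomial_mem_degreeSupported 1 (by simp)

theorem monomial_smul_mem_degreeSupported {v : ι → MvPolynomial σ R} {e : ℕ}
    (hv : v ∈ degreeSupported w deg {e}) (u : σ →₀ ℕ) (c : R) :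
    monomial u c • v ∈ degreeSupported w deg {Finsupp.weight w u + e} := by
  classical
  rw [mem_degreeSupported] at hv ⊢
  intro k m hm
  rw [Pi.smul_apply, smul_eq_mul, coeff_monomial_mul'] at hm
  obtain ⟨hum, hm⟩ := ite_ne_right_iff.1 hm
  have hdeg : Finsupp.weight w (m - u) + deg k = e := hv k _ (right_ne_zero_of_mul hm)
  rw [Set.mem_singleton_iff, ← hdeg, ← add_tsub_cancel_of_le hum, map_add,
    add_tsub_cancel_left, add_assoc]

theorem exists_mem_degreeSupported_Iio [Finite ι] (w : σ → ℕ) (deg : ι → ℕ)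
    (v : ι → MvPolynomial σ R) : ∃ N, v ∈ degreeSupported w deg (Set.Iio N) := by
  have hfin : (⋃ k,
      (fun u => Finsupp.weight w u + deg k) '' ((v k).support : Set (σ →₀ ℕ))).Finite :=
    Set.finite_iUnion fun k => (v k).support.finite_toSet.image _
  obtain ⟨N, hN⟩ := hfin.bddAbove
  refine ⟨N + 1, mem_degreeSupported.2 fun k u hu => Nat.lt_succ_of_le (hN ?_)⟩
  exact Set.mem_iUnion.2 ⟨k, u, mem_support_iff.2 hu, rfl⟩

open Classical in
/-- The projection of a graded free module onto the part with degrees in `s`. -/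
noncomputable def degreePart (w : σ → ℕ) (deg : ι → ℕ) (s : Set ℕ) :
    (ι → MvPolynomial σ R) →ₗ[R] (ι → MvPolynomial σ R) :=
  LinearMap.pi fun k => ((basisMonomials σ R).constr R fun u =>
    if Finsupp.weight w u + deg k ∈ s then monomial u 1 else 0) ∘ₗ LinearMap.proj k

open Classical in
theorem coeff_degreePart (v : ι → MvPolynomial σ R) (k : ι) (u : σ →₀ ℕ) :
    coeff u (degreePart w deg s v k) =
      if Finsupp.weight w u + deg k ∈ s then coeff u (v k) else 0 := by
  have hlin : lcoeff R u ∘ₗ (basisMonomials σ R).constr R (fun m =>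
        if Finsupp.weight w m + deg k ∈ s then monomial m (1 : R) else 0) =
      if Finsupp.weight w u + deg k ∈ s then lcoeff R u else 0 := by
    refine (basisMonomials σ R).ext fun m => ?_
    rw [LinearMap.comp_apply, Module.Basis.constr_basis, coe_basisMonomials]
    by_cases hmu : m = u
    · subst hmu
      split_ifs <;> simp
    · split_ifs <;> simp [coeff_monomial, hmu]
  rw [degreePart, LinearMap.pi_apply, LinearMap.comp_apply, LinearMap.proj_apply,
    ← lcoeff_apply, ← LinearMap.comp_apply, hlin]
  split_ifs <;> rfl

theorem degreePart_mem (v : ι → MvPolynomial σ R) :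
    degreePart w deg s v ∈ degreeSupported w deg s := by
  classical
  refine mem_degreeSupported.2 fun k u hu => ?_
  rw [coeff_degreePart] at hu
  exact (ite_ne_right_iff.1 hu).1

theorem degreePart_eq_self {v : ι → MvPolynomial σ R} (hv : v ∈ degreeSupported w deg s) :
    degreePart w deg s v = v := by
  classical
  ext k u
  rw [coeff_degreePart, ite_eq_left_iff]
  exact fun hs => Eq.symm (of_not_not fun hu => hs (mem_degreeSupported.1 hv k u hu))

open Classical in
theorem degreePart_of_mem_singleton {v : ι → MvPolynomial σ R} {e : ℕ}
    (hv : v ∈ degreeSupported w deg {e}) : degreePart w deg s v = if e ∈ s then v else 0 := by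
  ext k u
  by_cases hu : coeff u (v k) = 0
  · split_ifs <;> simp [coeff_degreePart, hu]
  · have he : Finsupp.weight w u + deg k = e := mem_degreeSupported.1 hv k u hu
    rw [coeff_degreePart, he]
    split_ifs <;> rfl

variable {deg' : κ → ℕ} {D : (ι → MvPolynomial σ R) →ₗ[MvPolynomial σ R] (κ → MvPolynomial σ R)}

theorem map_degreePart [Finite ι] [DecidableEq ι]
    (hD : ∀ j, D (Pi.single j 1) ∈ degreeSupported w deg' {deg j}) (s : Set ℕ)
    (v : ι → MvPolynomial σ R) : D (degreePart w deg s v) = degreePart w deg' s (D v) := by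
  classical
  suffices D.restrictScalars R ∘ₗ degreePart w deg s = degreePart w deg' s ∘ₗ D.restrictScalars R
    from LinearMap.congr_fun this v
  refine LinearMap.pi_ext' fun j => (basisMonomials σ R).ext fun u => ?_
  have hsingle : (Pi.single j (monomial u 1) : ι → MvPolynomial σ R) =
      monomial u (1 : R) • Pi.single j 1 := by rw [← Pi.single_smul, smul_eq_mul, mul_one]
  simp only [LinearMap.comp_apply, LinearMap.coe_single, coe_basisMonomials,
    LinearMap.coe_restrictScalars]
  rw [degreePart_of_mem_singleton (single_monomial_mem_degreeSupported 1 rfl), hsingle, map_smul,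
    degreePart_of_mem_singleton (monomial_smul_mem_degreeSupported (hD j) u 1)]
  split_ifs
  · rw [map_smul]
  · rw [map_zero]

theorem exists_homogeneous_preimage [Finite ι] [DecidableEq ι]
    (hD : ∀ j, D (Pi.single j 1) ∈ degreeSupported w deg' {deg j}) {y : κ → MvPolynomial σ R}
    {e : ℕ} (hy : y ∈ degreeSupported w deg' {e}) (hyD : y ∈ LinearMap.range D) :
    ∃ v ∈ degreeSupported w deg {e}, D v = y := by
  obtain ⟨v, rfl⟩ := hyD
  exact ⟨degreePart w deg {e} v, degreePart_mem v,
    (map_degreePart hD {e} v).trans (degreePart_eq_self hy)⟩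

theorem map_mem_degreeSupported [Finite ι] [DecidableEq ι]
    (hD : ∀ j, D (Pi.single j 1) ∈ degreeSupported w deg' {deg j}) {v : ι → MvPolynomial σ R}
    (hv : v ∈ degreeSupported w deg s) : D v ∈ degreeSupported w deg' s := by
  rw [← degreePart_eq_self hv, map_degreePart hD]
  exact degreePart_mem _

theorem degreePart_X_smul [Finite ι] (i : σ) (v : ι → MvPolynomial σ R) :
    degreePart w deg s ((X i : MvPolynomial σ R) • v) =
      (X i : MvPolynomial σ R) • degreePart w (fun k => w i + deg k) s v := by
  classical
  refine (map_degreePart (D := LinearMap.lsmul _ _ (X i)) (fun k => ?_) s v).symm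
  have h := monomial_smul_mem_degreeSupported
    (single_one_mem_degreeSupported (w := w) (deg := deg) k) (Finsupp.single i 1) (1 : R)
  rw [Finsupp.weight_single, smul_eq_mul, one_mul] at h
  exact h

theorem exact_of_exact_mod_X [Finite ι] [DecidableEq ι] [Finite κ] {M : Type*} [AddCommGroup M]
    [Module (MvPolynomial σ R) M] {E : (κ → MvPolynomial σ R) →ₗ[MvPolynomial σ R] M} {i : σ}
    (hi : 0 < w i) (hreg : IsSMulRegular M (X i : MvPolynomial σ R))
    (hD : ∀ j, D (Pi.single j 1) ∈ degreeSupported w deg' {deg j}) (hED : E ∘ₗ D = 0)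
    (hmod : ∀ v, E v = 0 → ∃ u y, v - D u = (X i : MvPolynomial σ R) • y) :
    Function.Exact D E := by
  classical
  have hbounded : ∀ N, ∀ v ∈ degreeSupported w deg' (Set.Iio N), E v = 0 → v ∈ Set.range D := by
    intro N
    induction N with
    | zero =>
      intro v hv _
      refine ⟨0, (map_zero D).trans (funext fun k => ?_)⟩
      ext u
      by_contra hu
      exact Nat.not_lt_zero _ (mem_degreeSupported.1 hv k u (Ne.symm hu))
    | succ N ih =>
      intro v hv hEv
      obtain ⟨u, y, huy⟩ := hmod v hEv
      set y' := degreePart w (fun k => w i + deg' k) (Set.Iio (N + 1)) y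
      have huy' : v - D (degreePart w deg (Set.Iio (N + 1)) u) = (X i : MvPolynomial σ R) • y' := by
        rw [map_degreePart hD]
        nth_rewrite 1 [← degreePart_eq_self hv]
        rw [← map_sub, huy]
        exact degreePart_X_smul i y
      have hEy' : E y' = 0 := hreg <| by
        simp only [smul_zero]
        rw [← map_smul, ← huy', map_sub, hEv, zero_sub, neg_eq_zero]
        exact LinearMap.congr_fun hED _
      obtain ⟨z, hz⟩ := ih y' (mem_degreeSupported.2 fun k m hm => by
        have := mem_degreeSupported.1 (degreePart_mem y) k m hm
        simp only [Set.mem_Iio] at this ⊢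
        omega) hEy'
      exact ⟨(X i : MvPolynomial σ R) • z + degreePart w deg (Set.Iio (N + 1)) u, by
        rw [map_add, map_smul, hz, ← huy', sub_add_cancel]⟩
  refine fun v => ⟨fun hv => ?_, fun ⟨u, hu⟩ => hu ▸ LinearMap.congr_fun hED u⟩
  obtain ⟨N, hN⟩ := exists_mem_degreeSupported_Iio w deg' v
  exact hbounded N v hN hv

end GradedModule

section Augmentation

variable {K : Type*} [Field K] {n : Fin 4 → ℕ}

theorem toricMap_monomial (u : Fin 4 →₀ ℕ) (c : K) :
    toricMap K n (monomial u c) = Polynomial.monomial (Finsupp.weight n u) c := by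
  rw [toricMap, aeval_monomial, ← Polynomial.C_mul_X_pow_eq_monomial, Polynomial.algebraMap_eq,
    Finsupp.weight_apply, Finsupp.sum, ← Finset.prod_pow_eq_pow_sum]
  simp only [Finsupp.prod, ← pow_mul, smul_eq_mul, mul_comm (n _)]

theorem isHomogeneousVec_iff {r : ℕ} {deg : Fin r → ℕ} {v : Fin r → MvPolynomial (Fin 4) K}
    {e : ℕ} : IsHomogeneousVec n deg v e ↔ v ∈ degreeSupported n deg {e} := by
  simp only [mem_degreeSupported, IsHomogeneousVec, mem_support_iff, Set.mem_singleton_iff]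

variable {r : ℕ} {deg : Fin r → ℕ}
  {aug : (Fin r → MvPolynomial (Fin 4) K) →ₗ[MvPolynomial (Fin 4) K] semigroupRing K n}

theorem coe_aug_single_monomial
    {j : Fin r} {a : K} (ha : (aug (Pi.single j 1) : Polynomial K) = Polynomial.monomial (deg j) a)
    (u : Fin 4 →₀ ℕ) (c : K) : (aug (Pi.single j (monomial u c)) : Polynomial K) =
      Polynomial.monomial (Finsupp.weight n u + deg j) (c * a) := by
  have hsingle : (Pi.single j (monomial u c) : Fin r → MvPolynomial (Fin 4) K) =
      monomial u c • Pi.single j 1 := by rw [← Pi.single_smul, smul_eq_mul, mul_one]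
  have hsmul : ∀ x : semigroupRing K n, ((monomial u c • x : semigroupRing K n) : Polynomial K) =
      toricMap K n (monomial u c) * x := fun _ => rfl
  rw [hsingle, map_smul, hsmul, toricMap_monomial, ha, Polynomial.monomial_mul_monomial]

theorem coe_aug_degreePart
    (haug : ∀ j, ∃ c : K, (aug (Pi.single j 1) : Polynomial K) = Polynomial.monomial (deg j) c)
    (v : Fin r → MvPolynomial (Fin 4) K) (e : ℕ) :
    (aug (degreePart n deg {e} v) : Polynomial K) =
      Polynomial.monomial e ((aug v : Polynomial K).coeff e) := by
  choose a ha using haug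
  let val := (semigroupRing K n).val.toRingHom.toAddMonoidHom.comp aug.toAddMonoidHom
  suffices val.comp (degreePart n deg {e} : _ →ₗ[K] _).toAddMonoidHom =
      ((Polynomial.monomial e).comp (Polynomial.lcoeff K e)).toAddMonoidHom.comp val from
    DFunLike.congr_fun this v
  refine AddMonoidHom.functions_ext' _ _ _ fun j => AddMonoidAlgebra.addMonoidHom_ext fun u c => ?_
  change (aug (degreePart n deg {e} (Pi.single j (monomial u c))) : Polynomial K) =
    Polynomial.monomial e ((aug (Pi.single j (monomial u c)) : Polynomial K).coeff e)
  rw [degreePart_of_mem_singleton (single_monomial_mem_degreeSupported c rfl),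
    coe_aug_single_monomial (ha j), Polynomial.coeff_monomial]
  simp only [Set.mem_singleton_iff]
  split_ifs with he
  · rw [coe_aug_single_monomial (ha j), he]
  · simp

theorem exists_homogeneous_preimage_aug
    (haug : ∀ j, ∃ c : K, (aug (Pi.single j 1) : Polynomial K) = Polynomial.monomial (deg j) c)
    (hsurj : Function.Surjective aug) {y : semigroupRing K n} {e : ℕ}
    (hy : ∃ c : K, (y : Polynomial K) = Polynomial.monomial e c) :
    ∃ v ∈ degreeSupported n deg {e}, aug v = y := by
  obtain ⟨v, rfl⟩ := hsurj y
  obtain ⟨c, hc⟩ := hy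
  refine ⟨degreePart n deg {e} v, degreePart_mem v, Subtype.ext ?_⟩
  rw [coe_aug_degreePart haug, hc, Polynomial.coeff_monomial_same]

theorem exists_coe_aug_eq_monomial
    (haug : ∀ j, ∃ c : K, (aug (Pi.single j 1) : Polynomial K) = Polynomial.monomial (deg j) c)
    {v : Fin r → MvPolynomial (Fin 4) K} {e : ℕ} (hv : v ∈ degreeSupported n deg {e}) :
    ∃ c : K, (aug v : Polynomial K) = Polynomial.monomial e c :=
  ⟨_, by rw [← coe_aug_degreePart haug, degreePart_eq_self hv]⟩

end Augmentation

/-! ### Comparison of minimal covers -/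

section Comparison

variable {σ ι κ K M : Type*} [Field K] {w : σ → ℕ}
  [AddCommGroup M] [Module (MvPolynomial σ K) M]

theorem map_eq_sum_smul_single {R N : Type*} [Semiring R] [Fintype ι] [DecidableEq ι]
    [AddCommMonoid N] [Module R N] (f : (ι → R) →ₗ[R] N) (v : ι → R) :
    f v = ∑ k, v k • f (Pi.single k 1) := by
  conv_lhs => rw [← Finset.univ_sum_single v]
  simp only [map_sum, ← map_smul, ← Pi.single_smul, smul_eq_mul, mul_one]

theorem constantCoeff_map_eq_zero {R : Type*} [CommSemiring R] [Finite ι]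
    (f : (ι → MvPolynomial σ R) →ₗ[MvPolynomial σ R] (κ → MvPolynomial σ R))
    {v : ι → MvPolynomial σ R} (hv : ∀ j, constantCoeff (v j) = 0) (k : κ) :
    constantCoeff (f v k) = 0 := by
  classical
  cases nonempty_fintype ι
  rw [map_eq_sum_smul_single, Finset.sum_apply, map_sum]
  exact Finset.sum_eq_zero fun j _ => by rw [Pi.smul_apply, smul_eq_mul, map_mul, hv, zero_mul]

variable [DecidableEq ι] [DecidableEq κ]

/-- `f` maps every basis element to a nonzero scalar multiple of a basis element of the same
degree. -/
def MapsBasis (deg : ι → ℕ) (deg' : κ → ℕ)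
    (f : (ι → MvPolynomial σ K) →ₗ[MvPolynomial σ K] (κ → MvPolynomial σ K)) : Prop :=
  ∀ j, ∃ k, ∃ c : K, c ≠ 0 ∧ deg' k = deg j ∧ f (Pi.single j 1) = Pi.single k (C c)

theorem MapsBasis.map_single_mem {deg : ι → ℕ} {deg' : κ → ℕ}
    {f : (ι → MvPolynomial σ K) →ₗ[MvPolynomial σ K] (κ → MvPolynomial σ K)}
    (hf : MapsBasis deg deg' f) (j : ι) :
    f (Pi.single j 1) ∈ degreeSupported w deg' {deg j} := by
  obtain ⟨k, c, -, hk, h⟩ := hf j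
  rw [h]
  exact single_monomial_mem_degreeSupported c (by simp [hk])

/-- The isomorphism sending the `j`-th basis element to `c j` times the `e j`-th one. -/
noncomputable def monomialEquiv (e : ι ≃ κ) (c : ι → Kˣ) :
    (ι → MvPolynomial σ K) ≃ₗ[MvPolynomial σ K] (κ → MvPolynomial σ K) :=
  LinearEquiv.piCongrRight (fun j => LinearEquiv.smulOfUnit (Units.map C.toMonoidHom (c j))) ≪≫ₗ
    LinearEquiv.funCongrLeft _ _ e.symm

theorem monomialEquiv_single (e : ι ≃ κ) (c : ι → Kˣ) (j : ι) :
    monomialEquiv (σ := σ) e c (Pi.single j 1) = Pi.single (e j) (C (c j : K)) := by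
  ext1 k
  obtain ⟨l, rfl⟩ := e.surjective k
  obtain rfl | hlj := eq_or_ne l j
  · simp [monomialEquiv, LinearEquiv.smulOfUnit, Units.smul_def]
  · simp [monomialEquiv, LinearEquiv.smulOfUnit, hlj]

theorem exists_equiv_of_mul_eq_one [Fintype ι] [Fintype κ] {V : Matrix ι κ K} {W : Matrix κ ι K}
    (hVW : V * W = 1) (hWV : W * V = 1) {deg : ι → ℕ} {deg' : κ → ℕ}
    (hdeg : Function.Injective deg) (hV : ∀ j k, V j k ≠ 0 → deg' k = deg j) :
    ∃ e : ι ≃ κ, ∀ j, V j (e j) ≠ 0 := by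
  have hne : ∀ j, ∃ k, V j k ≠ 0 := fun j => by
    have hsum : ∑ k, V j k * W k j ≠ 0 := by
      rw [← Matrix.mul_apply, hVW, Matrix.one_apply_eq]
      exact one_ne_zero
    obtain ⟨k, -, hk⟩ := Finset.exists_ne_zero_of_sum_ne_zero hsum
    exact ⟨k, left_ne_zero_of_mul hk⟩
  choose e he using hne
  have hinj : Function.Injective e := fun j j' h =>
    hdeg <| by rw [← hV j _ (he j), ← hV j' _ (he j'), h]
  have hcard : Fintype.card ι = Fintype.card κ := Matrix.square_of_invertible V W hVW hWV
  exact ⟨Equiv.ofBijective e ((Fintype.bijective_iff_injective_and_card e).2 ⟨hinj, hcard⟩), he⟩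

theorem constantCoeff_mul_eq_one [Fintype κ]
    {p : (ι → MvPolynomial σ K) →ₗ[MvPolynomial σ K] M}
    {q : (κ → MvPolynomial σ K) →ₗ[MvPolynomial σ K] M}
    (hp : ∀ v, p v = 0 → ∀ k, constantCoeff (v k) = 0)
    {V : Matrix ι κ (MvPolynomial σ K)} (hV : ∀ j, q (V j) = p (Pi.single j 1))
    {W : Matrix κ ι (MvPolynomial σ K)} (hW : ∀ k, p (W k) = q (Pi.single k 1)) :
    V.map constantCoeff * W.map constantCoeff = 1 := by
  have hker : ∀ j, p ((V * W) j - Pi.single j 1) = 0 := fun j => by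
    rw [map_sub, sub_eq_zero, ← hV, Matrix.mul_apply_eq_vecMul, Matrix.vecMul_eq_sum, map_sum,
      map_eq_sum_smul_single q]
    simp only [map_smul, hW]
  ext j k
  rw [← Matrix.map_mul, Matrix.map_apply]
  have h := hp _ (hker j) k
  rw [Pi.sub_apply, map_sub, sub_eq_zero] at h
  rw [h, Pi.single_apply, Matrix.one_apply, apply_ite constantCoeff, map_one, map_zero]
  simp only [eq_comm]

omit [DecidableEq ι] in
theorem eq_of_constantCoeff_ne_zero {deg : ι → ℕ} {e : ℕ} {v : ι → MvPolynomial σ K}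
    (hv : v ∈ degreeSupported w deg {e}) {k : ι} (hk : constantCoeff (v k) ≠ 0) : deg k = e := by
  simpa using mem_degreeSupported.1 hv k 0 hk

theorem eq_single_C_of_mem_degreeSupported (hw : ∀ i, 0 < w i) {deg : ι → ℕ} {k : ι}
    (hdeg : ∀ l, k ≠ l → ∀ u : σ →₀ ℕ, deg k ≠ Finsupp.weight w u + deg l)
    {v : ι → MvPolynomial σ K}
    (hv : v ∈ degreeSupported w deg {deg k}) : v = Pi.single k (C (constantCoeff (v k))) := by
  classical
  have := Finsupp.nonTorsionWeight_of (R := ℕ) (w := w) fun i => (hw i).ne'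
  ext l u
  by_cases hu : coeff u (v l) = 0
  · obtain rfl | hlk := eq_or_ne l k
    · rw [hu, Pi.single_eq_same, coeff_C, eq_comm, ite_eq_right_iff]
      rintro rfl
      exact hu
    · rw [hu, Pi.single_eq_of_ne hlk, coeff_zero]
  · have hdegl : Finsupp.weight w u + deg l = deg k := mem_degreeSupported.1 hv l u hu
    obtain rfl : k = l := by_contra fun hkl => hdeg l hkl u hdegl.symm
    obtain rfl := (Finsupp.weight_eq_zero_iff_eq_zero w).1 (Nat.add_eq_right.1 hdegl)
    rw [Pi.single_eq_same, coeff_zero_C, constantCoeff_eq]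

theorem exists_mapsBasis_linearEquiv [Finite ι] [Finite κ] (hw : ∀ i, 0 < w i)
    {deg : ι → ℕ} {deg' : κ → ℕ} {p : (ι → MvPolynomial σ K) →ₗ[MvPolynomial σ K] M}
    {q : (κ → MvPolynomial σ K) →ₗ[MvPolynomial σ K] M}
    (hdeg : ∀ j j', j ≠ j' → ∀ u : σ →₀ ℕ, deg j ≠ Finsupp.weight w u + deg j')
    (hp : ∀ v, p v = 0 → ∀ k, constantCoeff (v k) = 0)
    (hq : ∀ v, q v = 0 → ∀ k, constantCoeff (v k) = 0)
    (hpq : ∀ j, ∃ v ∈ degreeSupported w deg' {deg j}, q v = p (Pi.single j 1))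
    (hqp : ∀ k, ∃ v, p v = q (Pi.single k 1)) :
    ∃ f : (ι → MvPolynomial σ K) ≃ₗ[MvPolynomial σ K] (κ → MvPolynomial σ K),
      MapsBasis deg deg' f.toLinearMap ∧ q ∘ₗ f.toLinearMap = p := by
  cases nonempty_fintype ι
  cases nonempty_fintype κ
  choose V hVdeg hV using hpq
  choose W hW using hqp
  have hinj : Function.Injective deg := fun j j' h => by
    by_contra hne
    exact hdeg j j' hne 0 (by simp [h])
  have hVne : ∀ j k, constantCoeff (V j k) ≠ 0 → deg' k = deg j := fun j k =>
    eq_of_constantCoeff_ne_zero (hVdeg j)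
  obtain ⟨e, he⟩ := exists_equiv_of_mul_eq_one (constantCoeff_mul_eq_one hp hV hW)
    (constantCoeff_mul_eq_one hq hW hV) hinj hVne
  have hdege : ∀ j, deg' (e j) = deg j := fun j => hVne j _ (he j)
  have hVsingle : ∀ j, V j = Pi.single (e j) (C (constantCoeff (V j (e j)))) := fun j => by
    refine eq_single_C_of_mem_degreeSupported hw (fun l hl u => ?_) ((hdege j).symm ▸ hVdeg j)
    obtain ⟨j', rfl⟩ := e.surjective l
    rw [hdege, hdege]
    exact hdeg j j' (fun h => hl (h ▸ rfl)) u
  let f := monomialEquiv (σ := σ) e fun j => Units.mk0 _ (he j)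
  have hf : ∀ j, f (Pi.single j 1) = V j := fun j =>
    (monomialEquiv_single e _ j).trans (hVsingle j).symm
  refine ⟨f, fun j => ⟨e j, _, he j, hdege j, (hf j).trans (hVsingle j)⟩, ?_⟩
  refine LinearMap.pi_ext' fun j => LinearMap.ext_ring ?_
  simp only [LinearMap.comp_apply, LinearMap.single_apply, LinearEquiv.coe_coe, hf, hV]

end Comparison

namespace MinimalGradedResolution

variable {K : Type*} [Field K] {n : Fin 4 → ℕ}

/-- The free module in homological degree `i`. -/
abbrev obj (G : MinimalGradedResolution K n) (i : ℕ) : Type _ :=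
  Fin (G.rank i) → MvPolynomial (Fin 4) K

theorem d_single_mem (G : MinimalGradedResolution K n) (i : ℕ) (j : Fin (G.rank (i + 1))) :
    G.d i (Pi.single j 1) ∈ degreeSupported n (G.deg i) {G.deg (i + 1) j} :=
  isHomogeneousVec_iff.1 (G.d_homogeneous i j)

theorem constantCoeff_d (G : MinimalGradedResolution K n) (i : ℕ)
    (v : G.obj (i + 1)) (k : Fin (G.rank i)) :
    constantCoeff (G.d i v k) = 0 := by
  rw [map_eq_sum_smul_single, Finset.sum_apply, map_sum]
  exact Finset.sum_eq_zero fun j _ => by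
    rw [Pi.smul_apply, smul_eq_mul, map_mul, G.minimal, mul_zero]

theorem constantCoeff_of_d_eq_zero (G : MinimalGradedResolution K n) {i : ℕ}
    {v : G.obj (i + 1)} (hv : G.d i v = 0)
    (k : Fin (G.rank (i + 1))) : constantCoeff (v k) = 0 := by
  obtain ⟨x, rfl⟩ := (G.exact_succ i v).1 hv
  exact G.constantCoeff_d _ x k

theorem constantCoeff_of_aug_eq_zero (G : MinimalGradedResolution K n)
    {v : G.obj 0} (hv : G.aug v = 0)
    (k : Fin (G.rank 0)) : constantCoeff (v k) = 0 := by
  obtain ⟨x, rfl⟩ := (G.exact_zero v).1 hv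
  exact G.constantCoeff_d _ x k

/-- `f` identifies the based modules of `F` and `G` in homological degree `i`, and the images of
the differentials in them; the latter is what lets `f` be lifted one degree further. -/
structure IsMatching (F G : MinimalGradedResolution K n) (i : ℕ)
    (f : F.obj i ≃ₗ[MvPolynomial (Fin 4) K] G.obj i) : Prop where
  mapsBasis : MapsBasis (F.deg i) (G.deg i) f.toLinearMap
  map_range : (LinearMap.range (F.d i)).map f.toLinearMap = LinearMap.range (G.d i)

theorem isMatching_of_comp_eq {F G : MinimalGradedResolution K n} {i : ℕ} {M : Type*}
    [AddCommGroup M] [Module (MvPolynomial (Fin 4) K) M]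
    {f : F.obj i ≃ₗ[MvPolynomial (Fin 4) K] G.obj i}
    {p : F.obj i →ₗ[MvPolynomial (Fin 4) K] M}
    {q : G.obj i →ₗ[MvPolynomial (Fin 4) K] M}
    (hf : MapsBasis (F.deg i) (G.deg i) f.toLinearMap) (hp : Function.Exact (F.d i) p)
    (hq : Function.Exact (G.d i) q) (hpq : q ∘ₗ f.toLinearMap = p) : IsMatching F G i f where
  mapsBasis := hf
  map_range := by
    rw [← hp.linearMap_ker_eq, ← hq.linearMap_ker_eq, ← hpq, LinearMap.ker_comp,
      Submodule.map_comap_eq_of_surjective f.surjective]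

theorem exists_isMatching_zero (hn : ∀ i, 0 < n i) (F G : MinimalGradedResolution K n)
    (hF : ∀ j j', j ≠ j' → ∀ u : Fin 4 →₀ ℕ, F.deg 0 j ≠ Finsupp.weight n u + F.deg 0 j') :
    ∃ f, IsMatching F G 0 f := by
  obtain ⟨f, hf, hfaug⟩ := exists_mapsBasis_linearEquiv hn hF
    (fun _ => F.constantCoeff_of_aug_eq_zero) (fun _ => G.constantCoeff_of_aug_eq_zero)
    (fun j => exists_homogeneous_preimage_aug G.aug_homogeneous G.aug_surjective
      (F.aug_homogeneous j))
    (fun _ => F.aug_surjective _)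
  exact ⟨f, isMatching_of_comp_eq hf F.exact_zero G.exact_zero hfaug⟩

theorem IsMatching.exists_succ (hn : ∀ i, 0 < n i) {F G : MinimalGradedResolution K n} {i : ℕ}
    (hF : ∀ j j', j ≠ j' → ∀ u : Fin 4 →₀ ℕ,
      F.deg (i + 1) j ≠ Finsupp.weight n u + F.deg (i + 1) j')
    {f : F.obj i ≃ₗ[MvPolynomial (Fin 4) K] G.obj i} (hf : IsMatching F G i f) :
    ∃ f', IsMatching F G (i + 1) f' ∧ f.toLinearMap ∘ₗ F.d i = G.d i ∘ₗ f'.toLinearMap := by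
  have hrange : LinearMap.range (f.toLinearMap ∘ₗ F.d i) = LinearMap.range (G.d i) := by
    rw [LinearMap.range_comp, hf.map_range]
  have hfd : ∀ j, (f.toLinearMap ∘ₗ F.d i) (Pi.single j 1) ∈
      degreeSupported n (G.deg i) {F.deg (i + 1) j} := fun j =>
    map_mem_degreeSupported hf.mapsBasis.map_single_mem (F.d_single_mem i j)
  have hexact : Function.Exact (F.d (i + 1)) (f.toLinearMap ∘ₗ F.d i) := fun v =>
    (map_eq_zero_iff f f.injective).trans (F.exact_succ i v)
  obtain ⟨f', hf', hcomm⟩ := exists_mapsBasis_linearEquiv (p := f.toLinearMap ∘ₗ F.d i)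
    (q := G.d i) hn hF
    (fun v hv => F.constantCoeff_of_d_eq_zero ((map_eq_zero_iff f f.injective).1 hv))
    (fun _ => G.constantCoeff_of_d_eq_zero)
    (fun j => exists_homogeneous_preimage (G.d_single_mem i) (hfd j)
      (hrange ▸ LinearMap.mem_range_self _ _))
    (fun _ => LinearMap.mem_range.1 (hrange ▸ LinearMap.mem_range_self _ _))
  exact ⟨f', isMatching_of_comp_eq hf' hexact (G.exact_succ i) hcomm, hcomm.symm⟩

theorem stronglyIndispensable_of_deg (hn : ∀ i, 0 < n i) (F : MinimalGradedResolution K n)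
    (hF : ∀ i j j', j ≠ j' → ∀ u : Fin 4 →₀ ℕ, F.deg i j ≠ Finsupp.weight n u + F.deg i j') :
    F.StronglyIndispensable := by
  intro G
  choose lift hlift hcomm using fun i (f : {f // IsMatching F G i f}) =>
    f.2.exists_succ hn (hF (i + 1))
  obtain ⟨f₀, hf₀⟩ := exists_isMatching_zero hn F G (hF 0)
  let f : ∀ i, {f // IsMatching F G i f} := fun i =>
    Nat.rec ⟨f₀, hf₀⟩ (fun i f => ⟨lift i f, hlift i f⟩) i
  exact ⟨fun i => (f i).1.toLinearMap, fun i => hcomm i (f i), fun i => (f i).1.injective,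
    fun i => (f i).2.mapsBasis⟩

end MinimalGradedResolution

/-! ### Changing the bases of a resolution -/

section Transvection

variable {σ ι κ K : Type*} [Field K] [DecidableEq ι] [DecidableEq κ] {w : σ → ℕ} {deg : ι → ℕ}
  {deg' : κ → ℕ}

/-- The automorphism adding `X ^ u` times the `k`-th basis element to the `j`-th one. -/
noncomputable def basisTransvection (u : σ →₀ ℕ) {j k : ι} (hjk : j ≠ k) :
    (ι → MvPolynomial σ K) ≃ₗ[MvPolynomial σ K] (ι → MvPolynomial σ K) :=
  LinearEquiv.transvection (f := monomial u (1 : K) • LinearMap.proj j) (v := Pi.single k 1)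
    (by simp [hjk])

theorem basisTransvection_apply (u : σ →₀ ℕ) {j k : ι} (hjk : j ≠ k) (v : ι → MvPolynomial σ K) :
    basisTransvection u hjk v = v + (monomial u 1 * v j) • Pi.single k 1 :=
  rfl

theorem basisTransvection_single_mem {u : σ →₀ ℕ} {j k : ι} (hjk : j ≠ k)
    (h : deg j = Finsupp.weight w u + deg k) (l : ι) :
    basisTransvection (K := K) u hjk (Pi.single l 1) ∈ degreeSupported w deg {deg l} := by
  refine add_mem (single_one_mem_degreeSupported l) ?_
  obtain rfl | hlj := eq_or_ne l j
  · simpa [h] using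
      monomial_smul_mem_degreeSupported (single_one_mem_degreeSupported (w := w) k) u (1 : K)
  · simp [Pi.single_eq_of_ne hlj.symm]

theorem symm_single_mem_degreeSupported [Finite ι]
    {τ : (ι → MvPolynomial σ K) ≃ₗ[MvPolynomial σ K] (ι → MvPolynomial σ K)}
    (hτ : ∀ l, τ (Pi.single l 1) ∈ degreeSupported w deg {deg l}) (l : ι) :
    τ.symm (Pi.single l 1) ∈ degreeSupported w deg {deg l} := by
  obtain ⟨v, hv, hvl⟩ := exists_homogeneous_preimage (D := τ.toLinearMap) hτ
    (single_one_mem_degreeSupported l) ⟨τ.symm (Pi.single l 1), τ.apply_symm_apply _⟩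
  rwa [← hvl, LinearEquiv.coe_coe, τ.symm_apply_apply]

variable {f g : (ι → MvPolynomial σ K) →ₗ[MvPolynomial σ K] (κ → MvPolynomial σ K)}

theorem MapsBasis.exists_single_eq [Finite ι] (hf : MapsBasis deg deg' f) {k : κ}
    (hk : ∃ v, constantCoeff (f v k) ≠ 0) :
    ∃ j, ∃ c : K, c ≠ 0 ∧ f (Pi.single j 1) = Pi.single k (C c) := by
  cases nonempty_fintype ι
  obtain ⟨v, hv⟩ := hk
  rw [map_eq_sum_smul_single, Finset.sum_apply, map_sum] at hv
  obtain ⟨j, -, hj⟩ := Finset.exists_ne_zero_of_sum_ne_zero hv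
  obtain ⟨k', c, hc, -, hfj⟩ := hf j
  obtain rfl : k = k' := by
    by_contra hkk'
    exact hj (by rw [hfj, Pi.smul_apply, Pi.single_eq_of_ne hkk', smul_zero, map_zero])
  exact ⟨j, c, hc, hfj⟩

theorem MapsBasis.surjective [Finite ι] [Finite κ] (hf : MapsBasis deg deg' f)
    (h : ∀ k, ∃ v, constantCoeff (f v k) ≠ 0) : Function.Surjective f := by
  cases nonempty_fintype κ
  intro v
  choose j c hc hj using fun k => hf.exists_single_eq (h k)
  refine ⟨∑ k, (v k * C (c k)⁻¹) • Pi.single (j k) 1, ?_⟩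
  simp only [map_sum, map_smul, hj]
  simp only [← Pi.single_smul, smul_eq_mul, mul_assoc, ← C_mul, inv_mul_cancel₀ (hc _), C_1,
    mul_one]
  exact Finset.univ_sum_single v

theorem MapsBasis.eq_smul [Finite ι] (hf : MapsBasis deg deg' f) (hg : MapsBasis deg deg' g) {c : K}
    (hc : c ≠ 0) (h : ∀ v k, constantCoeff ((g - (C c : MvPolynomial σ K) • f) v k) = 0) :
    g = (C c : MvPolynomial σ K) • f := by
  refine LinearMap.pi_ext' fun l => LinearMap.ext_ring ?_
  obtain ⟨k, a, ha, -, hfl⟩ := hf l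
  obtain ⟨k', b, -, -, hgl⟩ := hg l
  have hk := h (Pi.single l 1) k
  simp only [LinearMap.sub_apply, LinearMap.smul_apply, hfl, hgl, ← Pi.single_smul, smul_eq_mul,
    ← C_mul, Pi.sub_apply, Pi.single_eq_same, map_sub, constantCoeff_C, sub_eq_zero] at hk
  obtain rfl : k = k' := by
    by_contra hkk'
    rw [Pi.single_eq_of_ne hkk', map_zero] at hk
    exact mul_ne_zero hc ha hk.symm
  rw [Pi.single_eq_same, constantCoeff_C] at hk
  simp only [LinearMap.comp_apply, LinearMap.single_apply, LinearMap.smul_apply, hfl, hgl, hk,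
    ← Pi.single_smul, smul_eq_mul, ← C_mul]

theorem MapsBasis.exists_eq_smul [Subsingleton ι] [Nonempty ι] [Subsingleton κ]
    (hf : MapsBasis deg deg' f) (hg : MapsBasis deg deg' g) :
    ∃ c : K, c ≠ 0 ∧ g = (C c : MvPolynomial σ K) • f := by
  inhabit ι
  obtain ⟨k, a, ha, -, hfl⟩ := hf default
  obtain ⟨k', b, hb, -, hgl⟩ := hg default
  obtain rfl := Subsingleton.elim k k'
  refine ⟨b / a, div_ne_zero hb ha, LinearMap.pi_ext' fun l => LinearMap.ext_ring ?_⟩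
  obtain rfl := Subsingleton.elim default l
  simp only [LinearMap.comp_apply, LinearMap.single_apply, LinearMap.smul_apply, hfl, hgl,
    ← Pi.single_smul, smul_eq_mul, ← C_mul, div_mul_cancel₀ b ha]

end Transvection

namespace MinimalGradedResolution

variable {K : Type*} [Field K] {n : Fin 4 → ℕ}

/-- Transport of a resolution along homogeneous automorphisms of its free modules. -/
noncomputable def changeBasis (R : MinimalGradedResolution K n)
    (τ : ∀ i, R.obj i ≃ₗ[MvPolynomial (Fin 4) K] R.obj i)
    (hτ : ∀ i j, τ i (Pi.single j 1) ∈ degreeSupported n (R.deg i) {R.deg i j}) :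
    MinimalGradedResolution K n where
  rank := R.rank
  deg := R.deg
  d i := (τ i).symm.toLinearMap ∘ₗ R.d i ∘ₗ (τ (i + 1)).toLinearMap
  aug := R.aug ∘ₗ (τ 0).toLinearMap
  d_homogeneous i j := isHomogeneousVec_iff.2 <|
    map_mem_degreeSupported (symm_single_mem_degreeSupported (hτ i)) <|
      map_mem_degreeSupported (R.d_single_mem i) (hτ (i + 1) j)
  aug_homogeneous j := exists_coe_aug_eq_monomial R.aug_homogeneous (hτ 0 j)
  aug_surjective := R.aug_surjective.comp (τ 0).surjective
  exact_zero := (Function.Exact.iff_of_ladder_linearEquiv (e₁ := τ 1) (e₂ := τ 0)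
    (e₃ := LinearEquiv.refl _ _) (by ext; simp) (by ext; simp)).1 R.exact_zero
  exact_succ i := (Function.Exact.iff_of_ladder_linearEquiv (e₁ := τ (i + 2)) (e₂ := τ (i + 1))
    (e₃ := τ i) (by ext; simp) (by ext; simp)).1 (R.exact_succ i)
  minimal i j k := constantCoeff_map_eq_zero (τ i).symm.toLinearMap (R.constantCoeff_d i _) k

theorem nonempty_fin_rank_zero (F : MinimalGradedResolution K n) : Nonempty (Fin (F.rank 0)) := by
  by_contra h
  rw [not_nonempty_iff] at h
  obtain ⟨v, hv⟩ := F.aug_surjective 1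
  rw [Subsingleton.elim v 0, map_zero] at hv
  exact zero_ne_one hv

theorem aug_eq_zero_iff (F : MinimalGradedResolution K n) [Subsingleton (Fin (F.rank 0))]
    (j : Fin (F.rank 0)) (v : F.obj 0) : F.aug v = 0 ↔ toricMap K n (v j) = 0 := by
  have haug : ∀ v, (F.aug v : Polynomial K) =
      toricMap K n (v j) * (F.aug (Pi.single j 1) : Polynomial K) := fun v => by
    rw [map_eq_sum_smul_single, Fintype.sum_subsingleton _ j]
    rfl
  have hne : (F.aug (Pi.single j 1) : Polynomial K) ≠ 0 := fun h => by
    obtain ⟨v, hv⟩ := F.aug_surjective 1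
    have hone := haug v
    rw [h, mul_zero, hv] at hone
    exact one_ne_zero hone
  rw [← Subtype.coe_inj, haug, ZeroMemClass.coe_zero, mul_eq_zero, or_iff_left hne]

theorem d_single_ne_zero (R : MinimalGradedResolution K n) (i : ℕ) (k : Fin (R.rank (i + 1))) :
    R.d i (Pi.single k 1) ≠ 0 := fun h => by
  simpa using R.constantCoeff_of_d_eq_zero h k

/-- The maps that strong indispensability asks for. -/
structure IsEmbedding (F G : MinimalGradedResolution K n)
    (f : ∀ i, F.obj i →ₗ[MvPolynomial (Fin 4) K] G.obj i) : Prop where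
  comm : ∀ i, f i ∘ₗ F.d i = G.d i ∘ₗ f (i + 1)
  injective : ∀ i, Function.Injective (f i)
  mapsBasis : ∀ i, MapsBasis (F.deg i) (G.deg i) (f i)

theorem StronglyIndispensable.exists_isEmbedding {F : MinimalGradedResolution K n}
    (hF : F.StronglyIndispensable) (G : MinimalGradedResolution K n) : ∃ f, IsEmbedding F G f :=
  (hF G).imp fun _ h => ⟨h.1, h.2.1, h.2.2⟩

variable {F R : MinimalGradedResolution K n}
  {f g : ∀ i, F.obj i →ₗ[MvPolynomial (Fin 4) K] R.obj i}

theorem IsEmbedding.subsingleton_rank_zero (hf : IsEmbedding F R f)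
    [Subsingleton (Fin (R.rank 0))] : Subsingleton (Fin (F.rank 0)) := by
  refine ⟨fun j j' => by_contra fun hjj' => ?_⟩
  obtain ⟨k, c, -, -, h⟩ := hf.mapsBasis 0 j
  obtain ⟨k', c', hc', -, h'⟩ := hf.mapsBasis 0 j'
  obtain rfl := Subsingleton.elim k k'
  have heq : (C c' : MvPolynomial (Fin 4) K) • (Pi.single j 1 : F.obj 0) =
      (C c : MvPolynomial (Fin 4) K) • Pi.single j' 1 := hf.injective 0 <| by
    rw [map_smul, map_smul, h, h', ← Pi.single_smul, ← Pi.single_smul, smul_eq_mul, smul_eq_mul,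
      mul_comm]
  simpa [hjj', hc'] using congrFun heq j

theorem IsEmbedding.exact_zero (hf : IsEmbedding F R f) [Subsingleton (Fin (R.rank 0))] :
    Function.Exact (F.d 0) (R.aug ∘ₗ f 0) := fun v => by
  have := hf.subsingleton_rank_zero
  obtain ⟨j⟩ := F.nonempty_fin_rank_zero
  obtain ⟨k, c, hc, -, h⟩ := hf.mapsBasis 0 j
  have hunit : toricMap K n (C c) ≠ 0 := by
    rwa [C_apply, toricMap_monomial, ne_eq, Polynomial.monomial_eq_zero_iff]
  rw [← F.exact_zero v, F.aug_eq_zero_iff j, LinearMap.comp_apply, R.aug_eq_zero_iff k,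
    map_eq_sum_smul_single, Fintype.sum_subsingleton _ j, h, Pi.smul_apply, Pi.single_eq_same,
    smul_eq_mul, map_mul, mul_eq_zero, or_iff_left hunit]

theorem IsEmbedding.exact_succ (hf : IsEmbedding F R f) (i : ℕ) :
    Function.Exact (F.d (i + 1)) (R.d i ∘ₗ f (i + 1)) := by
  rw [← hf.comm]
  exact fun v => (map_eq_zero_iff (f i) (hf.injective i)).trans (F.exact_succ i v)

theorem IsEmbedding.exists_d_eq (hf : IsEmbedding F R f) [Subsingleton (Fin (R.rank 0))] {i : ℕ}
    (hi : Function.Surjective (f i)) (x : R.obj (i + 1)) :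
    ∃ y, R.d i x = R.d i (f (i + 1) y) := by
  obtain ⟨z, hz⟩ := hi (R.d i x)
  suffices z ∈ Set.range (F.d i) by
    obtain ⟨y, rfl⟩ := this
    exact ⟨y, by rw [← hz, ← LinearMap.comp_apply, hf.comm, LinearMap.comp_apply]⟩
  cases i with
  | zero =>
    refine (hf.exact_zero z).1 ?_
    rw [LinearMap.comp_apply, hz]
    exact R.exact_zero.apply_apply_eq_zero x
  | succ i =>
    refine (hf.exact_succ i z).1 ?_
    rw [LinearMap.comp_apply, hz]
    exact (R.exact_succ i).apply_apply_eq_zero x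

theorem IsEmbedding.surjective (hf : IsEmbedding F R f) [Subsingleton (Fin (R.rank 0))] (i : ℕ) :
    Function.Surjective (f i) := by
  induction i with
  | zero =>
    obtain ⟨j⟩ := F.nonempty_fin_rank_zero
    obtain ⟨k, c, hc, -, h⟩ := hf.mapsBasis 0 j
    refine (hf.mapsBasis 0).surjective fun k' => ⟨Pi.single j 1, ?_⟩
    rwa [Subsingleton.elim k' k, h, Pi.single_eq_same, constantCoeff_C]
  | succ i ih =>
    refine (hf.mapsBasis (i + 1)).surjective fun k => ?_
    obtain ⟨y, hy⟩ := hf.exists_d_eq ih (Pi.single k 1)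
    have hk := R.constantCoeff_of_d_eq_zero (sub_eq_zero.2 hy ▸ map_sub (R.d i) _ _) k
    refine ⟨y, ?_⟩
    rw [Pi.sub_apply, Pi.single_eq_same, map_sub, map_one, sub_eq_zero] at hk
    rw [← hk]
    exact one_ne_zero

theorem d_comp_sub_smul_eq_zero {i : ℕ} {c : K} (hf : f i ∘ₗ F.d i = R.d i ∘ₗ f (i + 1))
    (hg : g i ∘ₗ F.d i = R.d i ∘ₗ g (i + 1)) (h : g i = (C c : MvPolynomial (Fin 4) K) • f i) :
    R.d i ∘ₗ (g (i + 1) - (C c : MvPolynomial (Fin 4) K) • f (i + 1)) = 0 := by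
  rw [LinearMap.comp_sub, LinearMap.comp_smul, ← hf, ← hg, h, LinearMap.smul_comp, sub_self]

theorem exists_eq_smul_of_le [Subsingleton (Fin (F.rank 0))] [Subsingleton (Fin (R.rank 0))]
    (hf : ∀ i, f i ∘ₗ F.d i = R.d i ∘ₗ f (i + 1)) (hg : ∀ i, g i ∘ₗ F.d i = R.d i ∘ₗ g (i + 1))
    {m : ℕ} (hfb : ∀ i ≤ m, MapsBasis (F.deg i) (R.deg i) (f i))
    (hgb : ∀ i ≤ m, MapsBasis (F.deg i) (R.deg i) (g i)) :
    ∃ c : K, c ≠ 0 ∧ ∀ i ≤ m, g i = (C c : MvPolynomial (Fin 4) K) • f i := by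
  have := F.nonempty_fin_rank_zero
  obtain ⟨c, hc, h0⟩ := (hfb 0 m.zero_le).exists_eq_smul (hgb 0 m.zero_le)
  refine ⟨c, hc, fun i => ?_⟩
  induction i with
  | zero => exact fun _ => h0
  | succ i ih =>
    intro hi
    have hd := d_comp_sub_smul_eq_zero (hf i) (hg i) (ih (Nat.le_of_succ_le hi))
    exact (hfb _ hi).eq_smul (hgb _ hi) hc fun v =>
      R.constantCoeff_of_d_eq_zero (LinearMap.congr_fun hd v)

theorem d_basisTransvection_sub_ne_zero (R : MinimalGradedResolution K n) (i : ℕ)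
    {j k : Fin (R.rank (i + 1))} (hjk : j ≠ k) (u : Fin 4 →₀ ℕ) (l : Fin (R.rank (i + 1))) (b : K)
    {c : K} (hc : c ≠ 0) :
    R.d i (basisTransvection u hjk (Pi.single l (C b)) - Pi.single j (C c)) ≠ 0 := by
  intro h
  have hj := R.constantCoeff_of_d_eq_zero h j
  rw [basisTransvection_apply] at h hj
  simp only [Pi.sub_apply, Pi.add_apply, Pi.smul_apply, Pi.single_eq_of_ne hjk, smul_zero,
    add_zero, Pi.single_eq_same, map_sub, constantCoeff_C, sub_eq_zero] at hj
  obtain rfl : j = l := by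
    by_contra hjl
    rw [Pi.single_eq_of_ne hjl, map_zero] at hj
    exact hc hj.symm
  rw [Pi.single_eq_same, constantCoeff_C] at hj
  rw [hj, Pi.single_eq_same, add_sub_cancel_left, map_smul, smul_eq_zero_iff_left
    (R.d_single_ne_zero i k), mul_eq_zero, monomial_eq_zero, C_eq_zero] at h
  exact h.elim one_ne_zero hc

theorem StronglyIndispensable.exists_changeBasis (hF : F.StronglyIndispensable)
    {τ : ∀ i, R.obj i ≃ₗ[MvPolynomial (Fin 4) K] R.obj i}
    (hτ : ∀ i j, τ i (Pi.single j 1) ∈ degreeSupported n (R.deg i) {R.deg i j}) :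
    ∃ f : ∀ i, F.obj i →ₗ[MvPolynomial (Fin 4) K] R.obj i,
      (∀ i, ((τ i).toLinearMap ∘ₗ f i) ∘ₗ F.d i = R.d i ∘ₗ (τ (i + 1)).toLinearMap ∘ₗ f (i + 1)) ∧
      ∀ i, MapsBasis (F.deg i) (R.deg i) (f i) := by
  obtain ⟨f, hf⟩ := hF.exists_isEmbedding (R.changeBasis τ hτ)
  refine ⟨f, fun i => LinearMap.ext fun v => ?_, hf.mapsBasis⟩
  exact (congrArg (τ i) (LinearMap.congr_fun (hf.comm i) v)).trans ((τ i).apply_symm_apply _)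

theorem not_stronglyIndispensable_of_deg (R : MinimalGradedResolution K n)
    [Subsingleton (Fin (R.rank 0))] (i : ℕ) {j k : Fin (R.rank (i + 1))} (hjk : j ≠ k)
    {u : Fin 4 →₀ ℕ} (hdeg : R.deg (i + 1) j = Finsupp.weight n u + R.deg (i + 1) k)
    (F : MinimalGradedResolution K n) : ¬ F.StronglyIndispensable := by
  intro hF
  let τ : ∀ m, R.obj m ≃ₗ[MvPolynomial (Fin 4) K] R.obj m :=
    Function.update (fun m => LinearEquiv.refl _ _) (i + 1) (basisTransvection u hjk)
  have hτ : ∀ m l, τ m (Pi.single l 1) ∈ degreeSupported n (R.deg m) {R.deg m l} :=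
    (Function.forall_update_iff _ fun m (e : R.obj m ≃ₗ[_] R.obj m) =>
      ∀ l, e (Pi.single l 1) ∈ degreeSupported n (R.deg m) {R.deg m l}).2
      ⟨basisTransvection_single_mem hjk hdeg, fun m _ => single_one_mem_degreeSupported⟩
  obtain ⟨f, hf⟩ := hF.exists_isEmbedding R
  obtain ⟨f', hg, hf'⟩ := hF.exists_changeBasis hτ
  let g : ∀ m, F.obj m →ₗ[MvPolynomial (Fin 4) K] R.obj m := fun m => (τ m).toLinearMap ∘ₗ f' m
  have hgb : ∀ m ≤ i, MapsBasis (F.deg m) (R.deg m) (g m) := fun m hm => by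
    have hτm : τ m = LinearEquiv.refl _ _ := Function.update_of_ne (by omega) _ _
    simp only [g, hτm]
    exact hf' m
  have := hf.subsingleton_rank_zero
  obtain ⟨c, hc, h⟩ := exists_eq_smul_of_le hf.comm hg (fun m _ => hf.mapsBasis m) hgb
  have hd := d_comp_sub_smul_eq_zero (g := g) (hf.comm i) (hg i) (h i le_rfl)
  obtain ⟨v, hv⟩ := hf.surjective (i + 1) (Pi.single j 1)
  obtain ⟨l, a, ha, hl⟩ := (hf.mapsBasis (i + 1)).exists_single_eq (k := j) ⟨v, by simp [hv]⟩
  obtain ⟨k', b, -, -, hl'⟩ := hf' (i + 1) l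
  have hτi : τ (i + 1) = basisTransvection u hjk := Function.update_self _ _ _
  refine R.d_basisTransvection_sub_ne_zero i hjk u k' b (mul_ne_zero hc ha) ?_
  have hdl := LinearMap.congr_fun hd (Pi.single l 1)
  rw [LinearMap.comp_apply, LinearMap.sub_apply, LinearMap.smul_apply, hl, ← Pi.single_smul,
    smul_eq_mul, ← C_mul] at hdl
  simp only [g, LinearMap.comp_apply, hl', hτi] at hdl
  exact hdl

end MinimalGradedResolution

/-! ### Binomial ideals -/

section BinomialCon

variable {σ ι : Type*} {lead tail : ι → σ →₀ ℕ}

/-- The congruence on exponent vectors generated by `lead i ∼ tail i`, the combinatorial shadow of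
the ideal generated by the binomials `X ^ lead i - X ^ tail i`. -/
noncomputable def binomialCon (lead tail : ι → σ →₀ ℕ) : AddCon (σ →₀ ℕ) :=
  addConGen fun u v => ∃ i, lead i = u ∧ tail i = v

theorem binomialCon_lead_tail (i : ι) : binomialCon lead tail (lead i) (tail i) :=
  AddConGen.Rel.of _ _ ⟨i, rfl, rfl⟩

theorem weight_eq_of_binomialCon {w : σ → ℕ}
    (hw : ∀ i, Finsupp.weight w (lead i) = Finsupp.weight w (tail i)) {u v : σ →₀ ℕ}
    (huv : binomialCon lead tail u v) : Finsupp.weight w u = Finsupp.weight w v := by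
  have hle : binomialCon lead tail ≤ AddCon.ker (Finsupp.weight w) :=
    AddCon.addConGen_le.2 <| by
      rintro _ _ ⟨i, rfl, rfl⟩
      exact hw i
  exact hle huv

theorem exists_binomialCon_forall_not_lead_le {w : σ → ℕ} {x : σ} (hx : 0 < w x)
    (hw : ∀ i, Finsupp.weight w (lead i) = Finsupp.weight w (tail i))
    (hlt : ∀ i, lead i x < tail i x) (u : σ →₀ ℕ) :
    ∃ v, binomialCon lead tail u v ∧ ∀ i, ¬ lead i ≤ v := by
  obtain ⟨d, hd⟩ : ∃ d, Finsupp.weight w u - u x = d := ⟨_, rfl⟩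
  induction d using Nat.strong_induction_on generalizing u with
  | _ d ih =>
  by_cases hu : ∀ i, ¬ lead i ≤ u
  · exact ⟨u, (binomialCon lead tail).refl u, hu⟩
  push Not at hu
  obtain ⟨i, hi⟩ := hu
  obtain ⟨m, rfl⟩ := exists_add_of_le hi
  have hstep : binomialCon lead tail (lead i + m) (tail i + m) :=
    (binomialCon lead tail).add (binomialCon_lead_tail i) ((binomialCon lead tail).refl m)
  have hweight := weight_eq_of_binomialCon hw hstep
  have hle := Finsupp.le_weight w hx.ne' (tail i + m)
  have hlt := hlt i
  simp only [Finsupp.add_apply] at hd hle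
  obtain ⟨v, huv, hv⟩ := ih _ (by simp only [Finsupp.add_apply]; lia) (tail i + m) rfl
  exact ⟨v, (binomialCon lead tail).trans hstep huv, hv⟩

theorem eq_of_binomialCon {u v : σ →₀ ℕ} (huv : binomialCon lead tail u v)
    (hu : ∀ i, ¬ lead i ≤ u ∧ ¬ tail i ≤ u) : u = v := by
  let IsReducible (u : σ →₀ ℕ) : Prop := ∃ i, lead i ≤ u ∨ tail i ≤ u
  have isReducible_add {u : σ →₀ ℕ} (h : IsReducible u) (m : σ →₀ ℕ) : IsReducible (u + m) :=
    h.imp fun i => Or.imp (·.trans le_self_add) (·.trans le_self_add)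
  let equalOrReducible : AddCon (σ →₀ ℕ) :=
    { r := fun u v => u = v ∨ IsReducible u ∧ IsReducible v
      iseqv :=
        { refl := fun u => Or.inl rfl
          symm := Or.imp Eq.symm And.symm
          trans := by
            rintro u v w (rfl | huv) (rfl | hvw)
            exacts [Or.inl rfl, Or.inr hvw, Or.inr huv, Or.inr ⟨huv.1, hvw.2⟩] }
      add' := by
        rintro u u' v v' (rfl | hu) (rfl | hv)
        · exact Or.inl rfl
        · rw [add_comm u, add_comm u]
          exact Or.inr ⟨isReducible_add hv.1 u, isReducible_add hv.2 u⟩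
        · exact Or.inr ⟨isReducible_add hu.1 v, isReducible_add hu.2 v⟩
        · exact Or.inr ⟨isReducible_add hu.1 v, isReducible_add hu.2 v'⟩ }
  have hle : binomialCon lead tail ≤ equalOrReducible := AddCon.addConGen_le.2 <| by
    rintro _ _ ⟨i, rfl, rfl⟩
    exact Or.inr ⟨⟨i, Or.inl le_rfl⟩, ⟨i, Or.inr le_rfl⟩⟩
  refine (hle huv).resolve_right fun ⟨⟨i, hi⟩, _⟩ => ?_
  exact hi.elim (hu i).1 (hu i).2

theorem monomial_sub_monomial_mem_of_binomialCon {R : Type*} [CommRing R]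
    {I : Ideal (MvPolynomial σ R)} (hI : ∀ i, monomial (lead i) 1 - monomial (tail i) 1 ∈ I)
    {u v : σ →₀ ℕ} (huv : binomialCon lead tail u v) : monomial u 1 - monomial v 1 ∈ I := by
  let e : Multiplicative (σ →₀ ℕ) →* MvPolynomial σ R ⧸ I :=
    (Ideal.Quotient.mk I).toMonoidHom.comp (monomialOneHom R σ)
  have hle : binomialCon lead tail ≤ AddCon.ker e.toAdditiveRight := AddCon.addConGen_le.2 <| by
    rintro _ _ ⟨i, rfl, rfl⟩
    exact Ideal.Quotient.eq.2 (hI i)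
  exact Ideal.Quotient.eq.1 (hle huv)

end BinomialCon

section ToricKernel

variable {K : Type*} [Field K] {n : Fin 4 → ℕ}

theorem mem_of_toricMap_eq_zero {I : Ideal (MvPolynomial (Fin 4) K)}
    (hI : ∀ u v : Fin 4 →₀ ℕ, Finsupp.weight n u = Finsupp.weight n v →
      monomial u 1 - monomial v 1 ∈ I)
    {x : MvPolynomial (Fin 4) K} (hx : toricMap K n x = 0) : x ∈ I := by
  let representative : ℕ → Fin 4 →₀ ℕ := Function.invFun (Finsupp.weight n)
  let lift : Polynomial K →ₗ[K] MvPolynomial (Fin 4) K ⧸ I :=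
    (Polynomial.basisMonomials K).constr K fun s =>
      Ideal.Quotient.mk I (monomial (representative s) 1)
  have hlift : lift ∘ₗ (toricMap K n).toLinearMap = (Ideal.Quotient.mkₐ K I).toLinearMap := by
    refine (basisMonomials (Fin 4) K).ext fun u => ?_
    have hbasis := (Polynomial.basisMonomials K).constr_basis K
      (fun s => Ideal.Quotient.mk I (monomial (representative s) 1)) (Finsupp.weight n u)
    rw [Polynomial.coe_basisMonomials] at hbasis
    rw [coe_basisMonomials, LinearMap.comp_apply, AlgHom.toLinearMap_apply, toricMap_monomial]
    refine hbasis.trans (Ideal.Quotient.eq.2 (hI _ _ ?_))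
    exact Function.invFun_eq ⟨u, rfl⟩
  rw [← Ideal.Quotient.eq_zero_iff_mem]
  simpa [hx] using (LinearMap.congr_fun hlift x).symm

end ToricKernel

theorem exists_weight_natCast_eq {ι : Type*} [Fintype ι] {n : ι → ℕ}
    (hn : Finset.univ.gcd n = 1) (m : ℕ) [NeZero m] (z : ZMod m) :
    ∃ u : ι →₀ ℕ, (Finsupp.weight n u : ZMod m) = z := by
  obtain ⟨N, hN⟩ := Nat.exists_mem_closure_of_ge (Set.range n)
  have hgcd : Nat.setGcd (Set.range n) = 1 := by
    rw [← Nat.dvd_one, ← hn, Finset.dvd_gcd_iff]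
    exact fun i _ => Nat.setGcd_dvd_of_mem ⟨i, rfl⟩
  have hmem := hN (z.val + m * N)
    ((Nat.le_mul_of_pos_left N (NeZero.pos m)).trans (Nat.le_add_left _ _)) (by simp [hgcd])
  obtain ⟨u, hu⟩ := AddSubmonoid.exists_finsupp_of_mem_closure_range _ _ hmem
  refine ⟨u, ?_⟩
  rw [Finsupp.weight_apply, ← hu]
  simp

section Exponent

/-- The exponent vector with the given entries. -/
noncomputable def exponent (e₀ e₁ e₂ e₃ : ℕ) : Fin 4 →₀ ℕ :=
  Finsupp.equivFunOnFinite.symm ![e₀, e₁, e₂, e₃]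

theorem weight_fin_four (n : Fin 4 → ℕ) (u : Fin 4 →₀ ℕ) :
    Finsupp.weight n u = u 0 * n 0 + u 1 * n 1 + u 2 * n 2 + u 3 * n 3 := by
  simp only [Finsupp.weight_eq_sum, Fin.sum_univ_four, smul_eq_mul]

theorem weight_exponent (n : Fin 4 → ℕ) (e₀ e₁ e₂ e₃ : ℕ) :
    Finsupp.weight n (exponent e₀ e₁ e₂ e₃) = e₀ * n 0 + e₁ * n 1 + e₂ * n 2 + e₃ * n 3 :=
  weight_fin_four n _

theorem monomial_exponent {R : Type*} [CommSemiring R] (e₀ e₁ e₂ e₃ : ℕ) :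
    (monomial (exponent e₀ e₁ e₂ e₃) 1 : MvPolynomial (Fin 4) R) =
      X 0 ^ e₀ * X 1 ^ e₁ * X 2 ^ e₂ * X 3 ^ e₃ := by
  rw [monomial_eq, C_1, one_mul, Finsupp.prod_fintype _ _ fun _ => pow_zero _, Fin.prod_univ_four]
  rfl

theorem exponent_le_iff {e₀ e₁ e₂ e₃ : ℕ} {u : Fin 4 →₀ ℕ} :
    exponent e₀ e₁ e₂ e₃ ≤ u ↔ e₀ ≤ u 0 ∧ e₁ ≤ u 1 ∧ e₂ ≤ u 2 ∧ e₃ ≤ u 3 := by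
  rw [Finsupp.le_def, Fin.forall_fin_succ, Fin.forall_fin_succ, Fin.forall_fin_succ,
    Fin.forall_fin_one]
  rfl

theorem exponent_le_exponent_iff {e₀ e₁ e₂ e₃ f₀ f₁ f₂ f₃ : ℕ} :
    exponent e₀ e₁ e₂ e₃ ≤ exponent f₀ f₁ f₂ f₃ ↔ e₀ ≤ f₀ ∧ e₁ ≤ f₁ ∧ e₂ ≤ f₂ ∧ e₃ ≤ f₃ :=
  exponent_le_iff

end Exponent

/-! ### The defining ideal -/

/-- The numerical data of Komeda's description of the generators, in terms of `p = α₂₁`,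
`q = α₁ - α₂₁ - 1`, `a = α₂ - 1`, `b = α₃ - 1` and `c = α₄ - 1`. The three relations say that the
binomials `X₂ X₃ ^ c - X₀ ^ (p + q + 1)`, `X₁ ^ (a + 1) - X₀ ^ p X₃` and
`X₂ ^ (b + 1) - X₀ ^ q X₁` are homogeneous. -/
structure KomedaRelations (n : Fin 4 → ℕ) (p q a b c : ℕ) : Prop where
  pos : ∀ i, 0 < n i
  gcd_eq_one : Finset.univ.gcd n = 1
  p_pos : 0 < p
  q_pos : 0 < q
  a_pos : 0 < a
  b_pos : 0 < b
  c_pos : 0 < c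
  n_zero : n 0 = (a + 1) * (b + 1) * c + 1
  rel₀ : n 2 + c * n 3 = (p + q + 1) * n 0
  rel₁ : (a + 1) * n 1 = p * n 0 + n 3
  rel₂ : (b + 1) * n 2 = q * n 0 + n 1

/-- The terms free of `X₀` in the five binomials generating the defining ideal. -/
noncomputable def komedaLead (a b c : ℕ) : Fin 5 → Fin 4 →₀ ℕ :=
  ![exponent 0 0 1 c, exponent 0 (a + 1) 0 0, exponent 0 0 (b + 1) 0, exponent 0 0 0 (c + 1),
    exponent 0 1 0 c]

/-- The terms divisible by `X₀` in the five binomials generating the defining ideal. -/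
noncomputable def komedaTail (p q a b : ℕ) : Fin 5 → Fin 4 →₀ ℕ :=
  ![exponent (p + q + 1) 0 0 0, exponent p 0 0 1, exponent q 1 0 0, exponent 1 a b 0,
    exponent (p + 1) 0 b 0]

theorem forall_not_komedaLead_le_iff {a b c : ℕ} {u : Fin 4 →₀ ℕ} :
    (∀ i, ¬ komedaLead a b c i ≤ u) ↔
      u 1 ≤ a ∧ u 2 ≤ b ∧ (u 3 < c ∨ u 1 = 0 ∧ u 2 = 0 ∧ u 3 = c) := by
  simp only [Fin.forall_fin_succ, komedaLead, Fin.forall_fin_zero, exponent_le_iff,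
    Matrix.cons_val_zero, Matrix.cons_val_succ]
  lia

namespace KomedaRelations

variable {n : Fin 4 → ℕ} {p q a b c : ℕ}

theorem weight_komedaLead (h : KomedaRelations n p q a b c) (i : Fin 5) :
    Finsupp.weight n (komedaLead a b c i) = Finsupp.weight n (komedaTail p q a b i) := by
  have h₀ := h.rel₀
  have h₁ := h.rel₁
  have h₂ := h.rel₂
  fin_cases i <;> simp only [komedaLead, komedaTail, Fin.zero_eta, Fin.mk_one, Fin.reduceFinMk,
    Matrix.cons_val, weight_exponent] <;> linarith

theorem exists_binomialCon (h : KomedaRelations n p q a b c) (u : Fin 4 →₀ ℕ) :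
    ∃ v, binomialCon (komedaLead a b c) (komedaTail p q a b) u v ∧
      ∀ i, ¬ komedaLead a b c i ≤ v := by
  refine exists_binomialCon_forall_not_lead_le (h.pos 0) h.weight_komedaLead (fun i => ?_) u
  have hp := h.p_pos
  have hq := h.q_pos
  fin_cases i <;> simp [komedaLead, komedaTail, exponent, hp, hq]

theorem apply_eq_of_weight_natCast_eq (h : KomedaRelations n p q a b c) {u v : Fin 4 →₀ ℕ}
    (hu : ∀ i, ¬ komedaLead a b c i ≤ u) (hv : ∀ i, ¬ komedaLead a b c i ≤ v)
    (huv : (Finsupp.weight n u : ZMod (n 0)) = Finsupp.weight n v) :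
    u 1 = v 1 ∧ u 2 = v 2 ∧ u 3 = v 3 := by
  have : NeZero (n 0) := ⟨(h.pos 0).ne'⟩
  let box : Finset (ℕ × ℕ × ℕ) :=
    insert (0, 0, c) (Finset.range (a + 1) ×ˢ Finset.range (b + 1) ×ˢ Finset.range c)
  let residue (x : ℕ × ℕ × ℕ) : ZMod (n 0) := x.1 * n 1 + x.2.1 * n 2 + x.2.2 * n 3
  have mem_box {u : Fin 4 →₀ ℕ} (hu : ∀ i, ¬ komedaLead a b c i ≤ u) :
      (u 1, u 2, u 3) ∈ (box : Set (ℕ × ℕ × ℕ)) := by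
    rw [forall_not_komedaLead_le_iff] at hu
    simp only [box, Finset.mem_coe, Finset.mem_insert, Finset.mem_product, Finset.mem_range,
      Prod.mk.injEq]
    lia
  have residue_eq (u : Fin 4 →₀ ℕ) : residue (u 1, u 2, u 3) = Finsupp.weight n u := by
    simp [residue, weight_fin_four]
  have hsurj : Set.SurjOn residue box (Finset.univ : Finset (ZMod (n 0))) := fun z _ => by
    obtain ⟨u, rfl⟩ := exists_weight_natCast_eq h.gcd_eq_one (n 0) z
    obtain ⟨v, huv, hv⟩ := h.exists_binomialCon u
    exact ⟨_, mem_box hv, by rw [residue_eq, weight_eq_of_binomialCon h.weight_komedaLead huv]⟩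
  have hcard : box.card ≤ (Finset.univ : Finset (ZMod (n 0))).card := by
    refine (Finset.card_insert_le _ _).trans_eq ?_
    simp only [Finset.card_product, Finset.card_range, Finset.card_univ, ZMod.card, h.n_zero,
      mul_assoc]
  have hinj := Finset.injOn_of_surjOn_of_card_le residue (fun _ _ => Finset.mem_univ _) hsurj hcard
  simpa using hinj (mem_box hu) (mem_box hv) (by rw [residue_eq, residue_eq, huv])

theorem binomialCon_of_weight_eq (h : KomedaRelations n p q a b c) {u v : Fin 4 →₀ ℕ}
    (huv : Finsupp.weight n u = Finsupp.weight n v) :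
    binomialCon (komedaLead a b c) (komedaTail p q a b) u v := by
  obtain ⟨u', hu, hu'⟩ := h.exists_binomialCon u
  obtain ⟨v', hv, hv'⟩ := h.exists_binomialCon v
  have hweight : Finsupp.weight n u' = Finsupp.weight n v' := by
    rw [← weight_eq_of_binomialCon h.weight_komedaLead hu, huv,
      weight_eq_of_binomialCon h.weight_komedaLead hv]
  obtain ⟨h₁, h₂, h₃⟩ := h.apply_eq_of_weight_natCast_eq hu' hv' (congrArg _ hweight)
  have h₀ : u' 0 = v' 0 := by
    simpa only [weight_fin_four, h₁, h₂, h₃, add_left_inj, mul_left_inj' (h.pos 0).ne']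
      using hweight
  have heq : u' = v' := Finsupp.ext <| by simp [Fin.forall_fin_succ, h₀, h₁, h₂, h₃]
  exact AddCon.trans _ hu (AddCon.symm _ (heq ▸ hv))

theorem mem_span_of_toricMap_eq_zero {K : Type*} [Field K] (h : KomedaRelations n p q a b c)
    {x : MvPolynomial (Fin 4) K} (hx : toricMap K n x = 0) :
    x ∈ Ideal.span (Set.range fun i =>
      monomial (komedaLead a b c i) (1 : K) - monomial (komedaTail p q a b i) 1) := by
  refine mem_of_toricMap_eq_zero (fun u v huv => ?_) hx
  refine monomial_sub_monomial_mem_of_binomialCon (fun i => ?_) (h.binomialCon_of_weight_eq huv)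
  exact Ideal.subset_span ⟨i, rfl⟩

end KomedaRelations

/-! ### Reduction modulo the first variable -/

section KillFirst

open scoped Matrix

variable {R : Type*} [CommRing R] {m : ℕ}

/-- Setting the first variable to zero. -/
noncomputable def killFirst (R : Type*) [CommRing R] (m : ℕ) :
    MvPolynomial (Fin (m + 1)) R →+* MvPolynomial (Fin m) R :=
  Polynomial.constantCoeff.comp (finSuccEquiv R m : _ →+* Polynomial (MvPolynomial (Fin m) R))

theorem killFirst_X_zero : killFirst R m (X 0) = 0 := by
  simp [killFirst, finSuccEquiv_X_zero]

theorem killFirst_X_succ (i : Fin m) : killFirst R m (X i.succ) = X i := by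
  simp [killFirst, finSuccEquiv_X_succ]

theorem killFirst_rename_succ (x : MvPolynomial (Fin m) R) :
    killFirst R m (rename Fin.succ x) = x := by
  suffices (killFirst R m).comp (rename Fin.succ : _ →ₐ[R] _).toRingHom = RingHom.id _ from
    RingHom.congr_fun this x
  refine ringHom_ext (fun r => ?_) (fun i => ?_)
  · simp [killFirst, finSuccEquiv_apply]
  · simp [killFirst_X_succ]

theorem X_zero_dvd_of_killFirst_eq_zero {x : MvPolynomial (Fin (m + 1)) R}
    (hx : killFirst R m x = 0) : X 0 ∣ x := by
  rw [← map_dvd_iff (finSuccEquiv R m), finSuccEquiv_X_zero]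
  exact Polynomial.X_dvd_iff.2 hx

theorem exact_mulVecLin_of_exact_killFirst {r s t : ℕ} {w : Fin (m + 1) → ℕ} {deg : Fin s → ℕ}
    {deg' : Fin t → ℕ} {M : Matrix (Fin r) (Fin s) (MvPolynomial (Fin (m + 1)) R)}
    {N : Matrix (Fin s) (Fin t) (MvPolynomial (Fin (m + 1)) R)} (hw : 0 < w 0)
    (hN : ∀ j, N.col j ∈ degreeSupported w deg {deg' j}) (hMN : M * N = 0)
    (hexact : ∀ v, M.map (killFirst R m) *ᵥ v = 0 → ∃ u, N.map (killFirst R m) *ᵥ u = v) :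
    Function.Exact N.mulVecLin M.mulVecLin := by
  refine exact_of_exact_mod_X hw (IsSMulRegular.pi fun _ => isRegular_X.left) (deg' := deg)
    (deg := deg') (fun j => ?_) ?_ fun v hv => ?_
  · rw [Matrix.mulVecLin_apply, Matrix.mulVec_single_one]
    exact hN j
  · rw [← Matrix.mulVecLin_mul, hMN, Matrix.mulVecLin_zero]
  obtain ⟨u, hu⟩ := hexact (killFirst R m ∘ v) <| by
    funext k
    rw [← RingHom.map_mulVec, ← Matrix.mulVecLin_apply, hv, Pi.zero_apply, map_zero, Pi.zero_apply]
  have hdvd : ∀ k, X 0 ∣ (v - N.mulVecLin (rename Fin.succ ∘ u)) k := fun k => by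
    apply X_zero_dvd_of_killFirst_eq_zero
    have hlift : killFirst R m ∘ rename Fin.succ ∘ u = u :=
      funext fun j => killFirst_rename_succ (u j)
    rw [Pi.sub_apply, map_sub, Matrix.mulVecLin_apply, RingHom.map_mulVec, hlift, hu,
      Function.comp_apply, sub_self]
  choose y hy using hdvd
  exact ⟨rename Fin.succ ∘ u, y, funext hy⟩

end KillFirst

section Syzygies

variable {σ R : Type*} [CommRing R]

theorem mem_span_of_mul_X_pow_mem {x y z : σ} (hxz : x ≠ z) (hyz : y ≠ z) {i j k : ℕ}
    {w : MvPolynomial σ R} (h : w * X z ^ k ∈ Ideal.span {X x ^ i, X y ^ j}) :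
    w ∈ Ideal.span {X x ^ i, X y ^ j} := by
  classical
  have hset : ({X x ^ i, X y ^ j} : Set (MvPolynomial σ R)) =
      (fun s => monomial s (1 : R)) '' {Finsupp.single x i, Finsupp.single y j} := by
    simp only [Set.image_pair, X_pow_eq_monomial]
  rw [hset, mem_ideal_span_monomial_image] at h ⊢
  intro u hu
  obtain ⟨s, hs, hsu⟩ := h (u + Finsupp.single z k) (by
    rwa [X_pow_eq_monomial, mem_support_iff, coeff_mul_monomial, mul_one, ← mem_support_iff])
  refine ⟨s, hs, ?_⟩
  rcases hs with rfl | rfl <;> rw [Finsupp.single_le_iff] at hsu ⊢ <;>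
    simpa [Finsupp.single_apply, hxz.symm, hyz.symm] using hsu

variable [IsDomain R]

theorem X_pow_dvd_of_dvd_mul_X_pow {x y : σ} (hxy : x ≠ y) (i j : ℕ) {w : MvPolynomial σ R}
    (h : X x ^ i ∣ w * X y ^ j) : X x ^ i ∣ w :=
  X_prime.pow_dvd_of_dvd_mul_right i (fun hd => hxy (X_dvd_X.1 (X_prime.dvd_of_dvd_pow hd))) h

theorem exists_koszul_relation {x y z : σ} (hxy : x ≠ y) (hxz : x ≠ z) (hyz : y ≠ z) {i j k : ℕ}
    {f g h : MvPolynomial σ R} (hrel : f * X x ^ i + g * X y ^ j + h * X z ^ k = 0) :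
    ∃ r s t, f = r * X y ^ j + s * X z ^ k ∧ g = -r * X x ^ i + t * X z ^ k ∧
      h = -s * X x ^ i - t * X y ^ j := by
  obtain ⟨s, t, hst⟩ := Ideal.mem_span_pair.1 (mem_span_of_mul_X_pow_mem hxz hyz
    (Ideal.mem_span_pair.2 ⟨-f, -g, by linear_combination -hrel⟩ :
      h * X z ^ k ∈ Ideal.span {X x ^ i, X y ^ j}))
  obtain ⟨r, hr⟩ := X_pow_dvd_of_dvd_mul_X_pow hxy i j
    (w := g + t * X z ^ k) ⟨-(f + s * X z ^ k), by linear_combination hrel + X z ^ k * hst⟩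
  refine ⟨-r, -s, -t, ?_, by linear_combination hr, by linear_combination -hst⟩
  have hX : (X x ^ i : MvPolynomial σ R) ≠ 0 := pow_ne_zero _ (X_ne_zero _)
  refine mul_right_cancel₀ hX ?_
  linear_combination hrel + X z ^ k * hst - X y ^ j * hr

/-- The relation splits as one between `x ^ (a + 1)`, `y ^ (b + 1)` and `z ^ c`, followed by one
between `x`, `y` and `z`; both are Koszul. -/
theorem exists_first_syzygy {x y z : σ} (hxy : x ≠ y) (hxz : x ≠ z) (hyz : y ≠ z) {a b c : ℕ}
    {v₀ v₁ v₂ v₃ v₄ : MvPolynomial σ R}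
    (h : X y * X z ^ c * v₀ + X x ^ (a + 1) * v₁ + X y ^ (b + 1) * v₂ + X z ^ (c + 1) * v₃ +
      X x * X z ^ c * v₄ = 0) :
    ∃ w₀ w₁ w₂ w₃ w₄ w₅ : MvPolynomial σ R,
      v₀ = -X x * w₀ - X y ^ b * w₂ - X z * w₄ ∧
      v₁ = X y ^ (b + 1) * w₁ + X z ^ c * w₅ ∧
      v₂ = -X x ^ (a + 1) * w₁ + X z ^ c * w₂ ∧
      v₃ = X x * w₃ + X y * w₄ ∧
      v₄ = X y * w₀ - X z * w₃ - X x ^ a * w₅ := by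
  obtain ⟨k₁, k₂, k₃, h₁, h₂, h₃⟩ := exists_koszul_relation hxy hxz hyz (i := a + 1) (j := b + 1)
    (k := c) (f := v₁) (g := v₂) (h := X y * v₀ + X z * v₃ + X x * v₄) (by linear_combination h)
  obtain ⟨l₁, l₂, l₃, h₄, h₅, h₆⟩ := exists_koszul_relation hxy hxz hyz (i := 1) (j := 1) (k := 1)
    (f := v₄ + k₂ * X x ^ a) (g := v₀ + k₃ * X y ^ b) (h := v₃) (by linear_combination h₃)
  exact ⟨l₁, k₁, k₃, -l₂, -l₃, k₂, by linear_combination h₅, by linear_combination h₁,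
    by linear_combination h₂, by linear_combination h₆, by linear_combination h₄⟩

theorem exists_second_syzygy {x y z : σ} (hxz : x ≠ z) (hyz : y ≠ z) {a b c : ℕ}
    {w₀ w₁ w₂ w₃ w₄ w₅ : MvPolynomial σ R}
    (h₀ : -X x * w₀ - X y ^ b * w₂ - X z * w₄ = 0)
    (h₁ : X y ^ (b + 1) * w₁ + X z ^ c * w₅ = 0)
    (h₂ : -X x ^ (a + 1) * w₁ + X z ^ c * w₂ = 0)
    (h₃ : X x * w₃ + X y * w₄ = 0) :
    ∃ s t : MvPolynomial σ R,
      w₀ = X z * s - X x ^ a * X y ^ b * t ∧ w₁ = X z ^ c * t ∧ w₂ = X x ^ (a + 1) * t ∧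
      w₃ = X y * s ∧ w₄ = -X x * s ∧ w₅ = -X y ^ (b + 1) * t := by
  have hz : (X z ^ c : MvPolynomial σ R) ≠ 0 := pow_ne_zero _ (X_ne_zero _)
  have hx : (X x : MvPolynomial σ R) ≠ 0 := X_ne_zero _
  obtain ⟨t, ht⟩ := X_pow_dvd_of_dvd_mul_X_pow hyz.symm c (b + 1) (w := w₁)
    ⟨-w₅, by linear_combination h₁⟩
  have hw₅ : w₅ = -X y ^ (b + 1) * t := mul_left_cancel₀ hz (by
    linear_combination h₁ - X y ^ (b + 1) * ht)
  have hw₂ : w₂ = X x ^ (a + 1) * t := mul_left_cancel₀ hz (by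
    linear_combination h₂ + X x ^ (a + 1) * ht)
  obtain ⟨s, hs⟩ := X_pow_dvd_of_dvd_mul_X_pow hxz 1 1 (w := -w₄)
    ⟨w₀ + X x ^ a * X y ^ b * t, by linear_combination h₀ + X y ^ b * hw₂⟩
  have hw₃ : w₃ = X y * s := mul_left_cancel₀ hx (by linear_combination h₃ + X y * hs)
  refine ⟨s, t, mul_left_cancel₀ hx ?_, ht, hw₂, hw₃, by linear_combination -hs, hw₅⟩
  linear_combination -h₀ + X z * hs - X y ^ b * hw₂

end Syzygies

/-! ### The minimal resolution -/

section KomedaMatrix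

open scoped Matrix

variable (K : Type*) [Field K] (p q a b c : ℕ)

/-- The matrix of the first differential, whose entries are the binomials
`X ^ komedaLead i - X ^ komedaTail i`. -/
noncomputable def komedaMatrix₀ : Matrix (Fin 1) (Fin 5) (MvPolynomial (Fin 4) K) :=
  !![X 2 * X 3 ^ c - X 0 ^ (p + q + 1), X 1 ^ (a + 1) - X 0 ^ p * X 3,
    X 2 ^ (b + 1) - X 0 ^ q * X 1, X 3 ^ (c + 1) - X 0 * X 1 ^ a * X 2 ^ b,
    X 1 * X 3 ^ c - X 0 ^ (p + 1) * X 2 ^ b]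

/-- The matrix of the second differential. Modulo `X 0` its columns `1`, `2`, `5` come from the
Koszul relations between `X 1 ^ (a + 1)`, `X 2 ^ (b + 1)` and `X 3 ^ c`, the others from those
between `X 1`, `X 2` and `X 3`. -/
noncomputable def komedaMatrix₁ : Matrix (Fin 5) (Fin 6) (MvPolynomial (Fin 4) K) :=
  !![-X 1, 0, -X 2 ^ b, 0, -X 3, 0;
    0, X 2 ^ (b + 1) - X 0 ^ q * X 1, 0, X 0 * X 2 ^ b, X 0 ^ (q + 1), X 3 ^ c;
    X 0 ^ (p + 1), X 0 ^ p * X 3 - X 1 ^ (a + 1), X 3 ^ c, 0, X 0 * X 1 ^ a, 0;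
    0, 0, 0, X 1, X 2, X 0 ^ p;
    X 2, 0, X 0 ^ q, -X 3, 0, -X 1 ^ a]

/-- The matrix of the third differential. -/
noncomputable def komedaMatrix₂ : Matrix (Fin 6) (Fin 2) (MvPolynomial (Fin 4) K) :=
  !![X 3, -(X 1 ^ a * X 2 ^ b);
    -X 0, X 3 ^ c;
    0, X 1 ^ (a + 1) - X 0 ^ p * X 3;
    X 2, -X 0 ^ (p + q);
    -X 1, X 0 ^ p * X 2 ^ b;
    0, X 0 ^ q * X 1 - X 2 ^ (b + 1)]

variable {K p q a b c}

theorem komedaMatrix₀_mul_komedaMatrix₁ :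
    komedaMatrix₀ K p q a b c * komedaMatrix₁ K p q a b c = 0 := by
  ext1 i j
  fin_cases i
  fin_cases j <;>
    simp [komedaMatrix₀, komedaMatrix₁, Matrix.mul_apply, Fin.sum_univ_succ] <;> ring

theorem komedaMatrix₁_mul_komedaMatrix₂ :
    komedaMatrix₁ K p q a b c * komedaMatrix₂ K p q a b c = 0 := by
  ext1 i j
  fin_cases i <;> fin_cases j <;>
    simp [komedaMatrix₁, komedaMatrix₂, Matrix.mul_apply, Fin.sum_univ_succ] <;> ring

section ModFirst

theorem killFirst_three_X :
    killFirst K 3 (X 1) = X 0 ∧ killFirst K 3 (X 2) = X 1 ∧ killFirst K 3 (X 3) = X 2 :=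
  ⟨killFirst_X_succ 0, killFirst_X_succ 1, killFirst_X_succ 2⟩

theorem komedaMatrix₀_map_killFirst (hp : p ≠ 0) (hq : q ≠ 0) :
    (komedaMatrix₀ K p q a b c).map (killFirst K 3) =
      !![X 1 * X 2 ^ c, X 0 ^ (a + 1), X 1 ^ (b + 1), X 2 ^ (c + 1), X 0 * X 2 ^ c] := by
  ext1 i j
  fin_cases i
  fin_cases j <;>
    simp [komedaMatrix₀, killFirst_X_zero, killFirst_three_X, hp, hq]

theorem komedaMatrix₁_map_killFirst (hp : p ≠ 0) (hq : q ≠ 0) :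
    (komedaMatrix₁ K p q a b c).map (killFirst K 3) =
      !![-X 0, 0, -X 1 ^ b, 0, -X 2, 0;
        0, X 1 ^ (b + 1), 0, 0, 0, X 2 ^ c;
        0, -X 0 ^ (a + 1), X 2 ^ c, 0, 0, 0;
        0, 0, 0, X 0, X 1, 0;
        X 1, 0, 0, -X 2, 0, -X 0 ^ a] := by
  ext1 i j
  fin_cases i <;> fin_cases j <;>
    simp [komedaMatrix₁, killFirst_X_zero, killFirst_three_X, hp, hq]

theorem komedaMatrix₂_map_killFirst (hp : p ≠ 0) (hq : q ≠ 0) :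
    (komedaMatrix₂ K p q a b c).map (killFirst K 3) =
      !![X 2, -(X 0 ^ a * X 1 ^ b);
        0, X 2 ^ c;
        0, X 0 ^ (a + 1);
        X 1, 0;
        -X 0, 0;
        0, -X 1 ^ (b + 1)] := by
  ext1 i j
  fin_cases i <;> fin_cases j <;>
    simp [komedaMatrix₂, killFirst_X_zero, killFirst_three_X, hp, hq]

theorem exists_komedaMatrix₁_mulVec_mod (hp : p ≠ 0) (hq : q ≠ 0)
    (v : Fin 5 → MvPolynomial (Fin 3) K)
    (hv : (komedaMatrix₀ K p q a b c).map (killFirst K 3) *ᵥ v = 0) :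
    ∃ u, (komedaMatrix₁ K p q a b c).map (killFirst K 3) *ᵥ u = v := by
  rw [komedaMatrix₀_map_killFirst hp hq] at hv
  obtain ⟨w₀, w₁, w₂, w₃, w₄, w₅, h₀, h₁, h₂, h₃, h₄⟩ := exists_first_syzygy (a := a) (b := b)
    (c := c) (by decide : (0 : Fin 3) ≠ 1) (by decide : (0 : Fin 3) ≠ 2) (by decide)
    (v₀ := v 0) (v₁ := v 1) (v₂ := v 2) (v₃ := v 3) (v₄ := v 4) <| by
      simpa [Matrix.mulVec, dotProduct, Fin.sum_univ_succ, add_assoc] using congrFun hv 0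
  refine ⟨![w₀, w₁, w₂, w₃, w₄, w₅], ?_⟩
  rw [komedaMatrix₁_map_killFirst hp hq]
  funext k
  fin_cases k <;> simp [h₀, h₁, h₂, h₃, h₄] <;> ring

theorem exists_komedaMatrix₂_mulVec_mod (hp : p ≠ 0) (hq : q ≠ 0)
    (v : Fin 6 → MvPolynomial (Fin 3) K)
    (hv : (komedaMatrix₁ K p q a b c).map (killFirst K 3) *ᵥ v = 0) :
    ∃ u, (komedaMatrix₂ K p q a b c).map (killFirst K 3) *ᵥ u = v := by
  rw [komedaMatrix₁_map_killFirst hp hq] at hv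
  have hrow (k) := congrFun hv k
  obtain ⟨s, t, h₀, h₁, h₂, h₃, h₄, h₅⟩ := exists_second_syzygy (a := a) (b := b) (c := c)
    (by decide : (0 : Fin 3) ≠ 2) (by decide : (1 : Fin 3) ≠ 2)
    (w₀ := v 0) (w₁ := v 1) (w₂ := v 2) (w₃ := v 3) (w₄ := v 4) (w₅ := v 5)
    (by
      simpa [Matrix.mulVec, dotProduct, Fin.sum_univ_succ, sub_eq_add_neg, add_assoc]
        using hrow 0)
    (by simpa [Matrix.mulVec, dotProduct, Fin.sum_univ_succ] using hrow 1)
    (by simpa [Matrix.mulVec, dotProduct, Fin.sum_univ_succ] using hrow 2)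
    (by simpa [Matrix.mulVec, dotProduct, Fin.sum_univ_succ] using hrow 3)
  refine ⟨![s, t], ?_⟩
  rw [komedaMatrix₂_map_killFirst hp hq]
  funext k
  fin_cases k <;> simp [h₀, h₁, h₂, h₃, h₄, h₅] <;> ring

theorem komedaMatrix₂_mulVec_mod_eq_zero (hp : p ≠ 0) (hq : q ≠ 0)
    (v : Fin 2 → MvPolynomial (Fin 3) K)
    (hv : (komedaMatrix₂ K p q a b c).map (killFirst K 3) *ᵥ v = 0) : v = 0 := by
  rw [komedaMatrix₂_map_killFirst hp hq] at hv
  have h₁ : v 1 = 0 := by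
    simpa [Matrix.mulVec, dotProduct, Fin.sum_univ_succ] using congrFun hv 2
  have h₀ : v 0 = 0 := by
    simpa [Matrix.mulVec, dotProduct, Fin.sum_univ_succ] using congrFun hv 3
  funext k
  fin_cases k
  exacts [h₀, h₁]

end ModFirst

end KomedaMatrix

section KomedaDegrees

variable (n : Fin 4 → ℕ) (p q a b c : ℕ)

/-- The degrees of the generators of the defining ideal. -/
def komedaDeg₁ : Fin 5 → ℕ :=
  ![(p + q + 1) * n 0, (a + 1) * n 1, (b + 1) * n 2, (c + 1) * n 3, n 1 + c * n 3]

/-- The degrees of the columns of `komedaMatrix₁`. -/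
def komedaDeg₂ : Fin 6 → ℕ :=
  ![(p + q + 1) * n 0 + n 1, (a + 1) * n 1 + (b + 1) * n 2, (p + q + 1) * n 0 + b * n 2,
    (c + 1) * n 3 + n 1, (p + q + 1) * n 0 + n 3, n 1 + c * n 3 + a * n 1]

/-- The degrees of the columns of `komedaMatrix₂`. -/
def komedaDeg₃ : Fin 2 → ℕ :=
  ![(p + q + 1) * n 0 + n 1 + n 3, (a + 1) * n 1 + (b + 1) * n 2 + c * n 3]

end KomedaDegrees

section Resolution

variable {K : Type*} [Field K] {n : Fin 4 → ℕ} {p q a b c : ℕ}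

theorem mem_restrictSupport_of_isWeightedHomogeneous {x : MvPolynomial (Fin 4) K} {m d e : ℕ}
    (hx : IsWeightedHomogeneous n x m) (hm : m + d = e) :
    x ∈ restrictSupport K {u | Finsupp.weight n u + d ∈ ({e} : Set ℕ)} :=
  (mem_restrictSupport_iff ..).2 fun u hu => by
    rw [Set.mem_ofPred_eq, hx (mem_support_iff.1 hu), hm, Set.mem_singleton_iff]

namespace KomedaRelations

theorem komedaMatrix₀_col_mem (h : KomedaRelations n p q a b c) (j : Fin 5) :
    (komedaMatrix₀ K p q a b c).col j ∈
      degreeSupported n (fun _ => 0) {komedaDeg₁ n p q a b c j} := by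
  have h₀ := h.rel₀
  have h₁ := h.rel₁
  have h₂ := h.rel₂
  refine Submodule.mem_pi.2 fun k _ => ?_
  fin_cases k
  fin_cases j <;>
    simp only [Matrix.col_apply, komedaMatrix₀, komedaDeg₁, Fin.zero_eta, Fin.mk_one,
      Fin.reduceFinMk, Matrix.of_apply, Matrix.cons_val] <;>
    refine sub_mem ?_ ?_ <;>
    refine mem_restrictSupport_of_isWeightedHomogeneous (by
      repeat' first
        | with_reducible exact isWeightedHomogeneous_X K n _
        | with_reducible apply IsWeightedHomogeneous.pow
        | with_reducible apply IsWeightedHomogeneous.mul)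
      (by simp only [smul_eq_mul]; linarith)

theorem komedaMatrix₁_col_mem (h : KomedaRelations n p q a b c) (j : Fin 6) :
    (komedaMatrix₁ K p q a b c).col j ∈
      degreeSupported n (komedaDeg₁ n p q a b c) {komedaDeg₂ n p q a b c j} := by
  have h₀ := h.rel₀
  have h₁ := h.rel₁
  have h₂ := h.rel₂
  refine Submodule.mem_pi.2 fun k _ => ?_
  fin_cases k <;> fin_cases j <;>
    simp only [Matrix.col_apply, komedaMatrix₁, komedaDeg₁, komedaDeg₂, Fin.zero_eta, Fin.mk_one,
      Fin.reduceFinMk, Matrix.of_apply, Matrix.cons_val] <;>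
    (repeat' first
      | with_reducible exact zero_mem _
      | with_reducible apply neg_mem
      | with_reducible apply sub_mem) <;>
    refine mem_restrictSupport_of_isWeightedHomogeneous (by
      repeat' first
        | with_reducible exact isWeightedHomogeneous_X K n _
        | with_reducible apply IsWeightedHomogeneous.pow
        | with_reducible apply IsWeightedHomogeneous.mul)
      (by (try simp only [smul_eq_mul]) <;> linarith)

theorem komedaMatrix₂_col_mem (h : KomedaRelations n p q a b c) (j : Fin 2) :
    (komedaMatrix₂ K p q a b c).col j ∈
      degreeSupported n (komedaDeg₂ n p q a b c) {komedaDeg₃ n p q a b c j} := by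
  have h₀ := h.rel₀
  have h₁ := h.rel₁
  have h₂ := h.rel₂
  refine Submodule.mem_pi.2 fun k _ => ?_
  fin_cases k <;> fin_cases j <;>
    simp only [Matrix.col_apply, komedaMatrix₂, komedaDeg₂, komedaDeg₃, Fin.zero_eta, Fin.mk_one,
      Fin.reduceFinMk, Matrix.of_apply, Matrix.cons_val] <;>
    (repeat' first
      | with_reducible exact zero_mem _
      | with_reducible apply neg_mem
      | with_reducible apply sub_mem) <;>
    refine mem_restrictSupport_of_isWeightedHomogeneous (by
      repeat' first
        | with_reducible exact isWeightedHomogeneous_X K n _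
        | with_reducible apply IsWeightedHomogeneous.pow
        | with_reducible apply IsWeightedHomogeneous.mul)
      (by (try simp only [smul_eq_mul]); linarith)

end KomedaRelations

variable (K n) in
/-- The surjection of `A` onto `K[S]`, as the augmentation of a complex with one basis element in
homological degree `0`. -/
noncomputable def toricAug :
    (Fin 1 → MvPolynomial (Fin 4) K) →ₗ[MvPolynomial (Fin 4) K] semigroupRing K n where
  toFun v := (toricMap K n).rangeRestrict (v 0)
  map_add' _ _ := map_add _ _ _
  map_smul' _ _ := map_mul _ _ _

theorem coe_toricAug (v : Fin 1 → MvPolynomial (Fin 4) K) :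
    (toricAug K n v : Polynomial K) = toricMap K n (v 0) := rfl

theorem toricAug_surjective : Function.Surjective (toricAug K n) := fun y => by
  obtain ⟨x, hx⟩ := (toricMap K n).rangeRestrict_surjective y
  exact ⟨fun _ => x, hx⟩

theorem komedaMatrix₀_apply (j : Fin 5) :
    komedaMatrix₀ K p q a b c 0 j =
      monomial (komedaLead a b c j) 1 - monomial (komedaTail p q a b j) 1 := by
  fin_cases j <;> simp [komedaMatrix₀, komedaLead, komedaTail, monomial_exponent]

namespace KomedaRelations

theorem exact_toricAug (h : KomedaRelations n p q a b c) :
    Function.Exact (komedaMatrix₀ K p q a b c).mulVecLin (toricAug K n) := fun v => by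
  rw [← Subtype.coe_inj, coe_toricAug, ZeroMemClass.coe_zero]
  constructor
  · intro hv
    obtain ⟨w, hw⟩ := Ideal.mem_span_range_iff_exists_fun.1 (h.mem_span_of_toricMap_eq_zero hv)
    refine ⟨w, funext fun k => ?_⟩
    rw [Subsingleton.elim k 0, ← hw]
    simp only [Matrix.mulVecLin_apply, Matrix.mulVec, dotProduct, komedaMatrix₀_apply, mul_comm]
  · rintro ⟨w, rfl⟩
    simp [Matrix.mulVec, dotProduct, komedaMatrix₀_apply, toricMap_monomial, h.weight_komedaLead]

theorem exact_komedaMatrix₀ (h : KomedaRelations n p q a b c) :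
    Function.Exact (komedaMatrix₁ K p q a b c).mulVecLin (komedaMatrix₀ K p q a b c).mulVecLin :=
  exact_mulVecLin_of_exact_killFirst (h.pos 0) h.komedaMatrix₁_col_mem
    komedaMatrix₀_mul_komedaMatrix₁
    (exists_komedaMatrix₁_mulVec_mod h.p_pos.ne' h.q_pos.ne')

theorem exact_komedaMatrix₁ (h : KomedaRelations n p q a b c) :
    Function.Exact (komedaMatrix₂ K p q a b c).mulVecLin (komedaMatrix₁ K p q a b c).mulVecLin :=
  exact_mulVecLin_of_exact_killFirst (h.pos 0) h.komedaMatrix₂_col_mem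
    komedaMatrix₁_mul_komedaMatrix₂
    (exists_komedaMatrix₂_mulVec_mod h.p_pos.ne' h.q_pos.ne')

theorem exact_komedaMatrix₂ (h : KomedaRelations n p q a b c) :
    Function.Exact
      (0 : (Fin 0 → MvPolynomial (Fin 4) K) →ₗ[MvPolynomial (Fin 4) K] Fin 2 → _)
      (komedaMatrix₂ K p q a b c).mulVecLin := by
  rw [← Matrix.mulVecLin_zero]
  exact exact_mulVecLin_of_exact_killFirst (h.pos 0) (deg := 0) (deg' := 0)
    (fun j => Fin.elim0 j) (Matrix.mul_zero _) fun v hv =>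
      ⟨0, by rw [Matrix.mulVec_zero, komedaMatrix₂_mulVec_mod_eq_zero h.p_pos.ne' h.q_pos.ne' v hv]⟩

theorem constantCoeff_komedaMatrix₀ (h : KomedaRelations n p q a b c) (k : Fin 1) (j : Fin 5) :
    constantCoeff (komedaMatrix₀ K p q a b c k j) = 0 := by
  fin_cases k
  fin_cases j <;> simp [komedaMatrix₀, h.p_pos.ne', h.q_pos.ne', h.c_pos.ne']

theorem constantCoeff_komedaMatrix₁ (h : KomedaRelations n p q a b c) (k : Fin 5) (j : Fin 6) :
    constantCoeff (komedaMatrix₁ K p q a b c k j) = 0 := by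
  fin_cases k <;> fin_cases j <;>
    simp [komedaMatrix₁, h.p_pos.ne', h.q_pos.ne', h.a_pos.ne', h.b_pos.ne', h.c_pos.ne']

theorem constantCoeff_komedaMatrix₂ (h : KomedaRelations n p q a b c) (k : Fin 6) (j : Fin 2) :
    constantCoeff (komedaMatrix₂ K p q a b c k j) = 0 := by
  fin_cases k <;> fin_cases j <;>
    simp [komedaMatrix₂, h.p_pos.ne', h.q_pos.ne', h.a_pos.ne', h.b_pos.ne', h.c_pos.ne']

end KomedaRelations

/-- The Betti numbers of `K[S]`. -/
def komedaRank : ℕ → ℕ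
  | 0 => 1
  | 1 => 5
  | 2 => 6
  | 3 => 2
  | _ => 0

variable (n p q a b c) in
/-- The degrees of the basis elements of `komedaResolution`. -/
def komedaDeg : ∀ i, Fin (komedaRank i) → ℕ
  | 0 => fun _ => 0
  | 1 => komedaDeg₁ n p q a b c
  | 2 => komedaDeg₂ n p q a b c
  | 3 => komedaDeg₃ n p q a b c
  | _ + 4 => Fin.elim0

variable (K p q a b c) in
/-- The differentials of `komedaResolution`. -/
noncomputable def komedaDifferential : ∀ i,
    (Fin (komedaRank (i + 1)) → MvPolynomial (Fin 4) K) →ₗ[MvPolynomial (Fin 4) K]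
      (Fin (komedaRank i) → MvPolynomial (Fin 4) K)
  | 0 => (komedaMatrix₀ K p q a b c).mulVecLin
  | 1 => (komedaMatrix₁ K p q a b c).mulVecLin
  | 2 => (komedaMatrix₂ K p q a b c).mulVecLin
  | _ + 3 => 0

section Columns

variable {r s : ℕ} {M : Matrix (Fin r) (Fin s) (MvPolynomial (Fin 4) K)} {j : Fin s}

theorem isHomogeneousVec_mulVecLin_single_one {deg : Fin r → ℕ} {e : ℕ}
    (hM : M.col j ∈ degreeSupported n deg {e}) :
    IsHomogeneousVec n deg (M.mulVecLin (Pi.single j 1)) e := by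
  rwa [isHomogeneousVec_iff, Matrix.mulVecLin_apply, Matrix.mulVec_single_one]

theorem constantCoeff_mulVecLin_single_one {k : Fin r} (hM : constantCoeff (M k j) = 0) :
    constantCoeff (M.mulVecLin (Pi.single j 1) k) = 0 := by
  rwa [Matrix.mulVecLin_apply, Matrix.mulVec_single_one, Matrix.col_apply]

end Columns

variable (K) in
/-- The minimal graded free resolution of `K[S]` given by the matrices `komedaMatrix₀`,
`komedaMatrix₁`, `komedaMatrix₂`. -/
noncomputable def komedaResolution (h : KomedaRelations n p q a b c) :
    MinimalGradedResolution K n where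
  rank := komedaRank
  deg := komedaDeg n p q a b c
  d := komedaDifferential K p q a b c
  aug := toricAug K n
  d_homogeneous
    | 0, j => isHomogeneousVec_mulVecLin_single_one (h.komedaMatrix₀_col_mem j)
    | 1, j => isHomogeneousVec_mulVecLin_single_one (h.komedaMatrix₁_col_mem j)
    | 2, j => isHomogeneousVec_mulVecLin_single_one (h.komedaMatrix₂_col_mem j)
    | _ + 3, j => Fin.elim0 j
  aug_homogeneous j := by
    obtain rfl : j = (0 : Fin 1) := Subsingleton.elim (α := Fin 1) j 0
    exact ⟨1, map_one (toricMap K n)⟩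
  aug_surjective := toricAug_surjective
  exact_zero := h.exact_toricAug
  exact_succ
    | 0 => h.exact_komedaMatrix₀
    | 1 => h.exact_komedaMatrix₁
    | 2 => h.exact_komedaMatrix₂
    | _ + 3 => fun v => ⟨fun _ => ⟨0, funext fun k => Fin.elim0 k⟩, fun _ => rfl⟩
  minimal
    | 0, j, k => constantCoeff_mulVecLin_single_one (h.constantCoeff_komedaMatrix₀ k j)
    | 1, j, k => constantCoeff_mulVecLin_single_one (h.constantCoeff_komedaMatrix₁ k j)
    | 2, j, k => constantCoeff_mulVecLin_single_one (h.constantCoeff_komedaMatrix₂ k j)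
    | _ + 3, j, _ => Fin.elim0 j

end Resolution

/-! ### The degrees of the resolution -/

section Degrees

/-- No term of the generating binomials divides
`X₀ ^ m₀ * X₁ ^ m₁ * X₂ ^ m₂ * X₃ ^ m₃`, so that this is the only monomial of its degree. -/
abbrev IsIsolatedExponent (p q a b c m₀ m₁ m₂ m₃ : ℕ) : Prop :=
  (m₂ = 0 ∨ m₃ < c) ∧ m₁ < a + 1 ∧ m₂ < b + 1 ∧ m₃ < c + 1 ∧ (m₁ = 0 ∨ m₃ < c) ∧
    m₀ < p + q + 1 ∧ (m₀ < p ∨ m₃ = 0) ∧ (m₀ < q ∨ m₁ = 0) ∧ (m₀ = 0 ∨ m₁ < a ∨ m₂ < b) ∧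
    (m₀ < p + 1 ∨ m₂ < b)

/-- The degrees `d` and `e` differ by no element of the semigroup, in either direction. -/
def IsIncomparable (n : Fin 4 → ℕ) (d e : ℕ) : Prop :=
  (∀ u : Fin 4 →₀ ℕ, d ≠ Finsupp.weight n u + e) ∧ ∀ u : Fin 4 →₀ ℕ, e ≠ Finsupp.weight n u + d

variable {n : Fin 4 → ℕ} {p q a b c d e : ℕ}

theorem IsIncomparable.symm (h : IsIncomparable n d e) : IsIncomparable n e d :=
  And.symm h

theorem IsIncomparable.congr {d' e' : ℕ} (h : IsIncomparable n d e) (hd : d' + e = e' + d) :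
    IsIncomparable n d' e' :=
  ⟨fun u hu => h.1 u (by omega), fun u hu => h.2 u (by omega)⟩

namespace KomedaRelations

theorem exponent_eq_of_weight_eq (h : KomedaRelations n p q a b c) {m₀ m₁ m₂ m₃ : ℕ}
    (hm : IsIsolatedExponent p q a b c m₀ m₁ m₂ m₃) {v : Fin 4 →₀ ℕ}
    (hv : Finsupp.weight n (exponent m₀ m₁ m₂ m₃) = Finsupp.weight n v) :
    exponent m₀ m₁ m₂ m₃ = v := by
  refine eq_of_binomialCon (h.binomialCon_of_weight_eq hv) fun i => ?_
  fin_cases i <;>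
    simp only [komedaLead, komedaTail, Fin.zero_eta, Fin.mk_one, Fin.reduceFinMk, Matrix.cons_val,
      exponent_le_exponent_iff] <;>
    omega

section Separation

variable (h : KomedaRelations n p q a b c) (m₀ m₁ m₂ m₃ k₀ k₁ k₂ k₃ : ℕ)
include h

theorem ne_weight_add
    (hd : d + (k₀ * n 0 + k₁ * n 1 + k₂ * n 2 + k₃ * n 3) =
      e + (m₀ * n 0 + m₁ * n 1 + m₂ * n 2 + m₃ * n 3))
    (hm : IsIsolatedExponent p q a b c m₀ m₁ m₂ m₃)
    (hk : m₀ < k₀ ∨ m₁ < k₁ ∨ m₂ < k₂ ∨ m₃ < k₃) (u : Fin 4 →₀ ℕ) :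
    d ≠ Finsupp.weight n u + e := fun hu => by
  have hmk : exponent m₀ m₁ m₂ m₃ = u + exponent k₀ k₁ k₂ k₃ :=
    h.exponent_eq_of_weight_eq hm (by rw [map_add, weight_exponent, weight_exponent]; omega)
  have hle := exponent_le_exponent_iff.1 (hmk ▸ le_add_self)
  omega

theorem isIncomparable_of_exponents
    (hd : d + (k₀ * n 0 + k₁ * n 1 + k₂ * n 2 + k₃ * n 3) =
      e + (m₀ * n 0 + m₁ * n 1 + m₂ * n 2 + m₃ * n 3))
    (hmk : IsIsolatedExponent p q a b c m₀ m₁ m₂ m₃ ∧ IsIsolatedExponent p q a b c k₀ k₁ k₂ k₃ ∧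
      (m₀ < k₀ ∨ m₁ < k₁ ∨ m₂ < k₂ ∨ m₃ < k₃) ∧ (k₀ < m₀ ∨ k₁ < m₁ ∨ k₂ < m₂ ∨ k₃ < m₃)) :
    IsIncomparable n d e :=
  ⟨h.ne_weight_add m₀ m₁ m₂ m₃ k₀ k₁ k₂ k₃ hd hmk.1 hmk.2.2.1,
    h.ne_weight_add k₀ k₁ k₂ k₃ m₀ m₁ m₂ m₃ hd.symm hmk.2.1 hmk.2.2.2⟩

end Separation

theorem isIncomparable_mul_one_mul_two (h : KomedaRelations n p q a b c) :
    IsIncomparable n ((a + 1) * n 1) ((b + 1) * n 2) := by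
  obtain ⟨-, -, hp, hq, ha, hb, hc, -, h₀, h₁, h₂⟩ := id h
  rcases le_total p q with hpq | hpq
  · obtain ⟨r, rfl⟩ := Nat.exists_eq_add_of_le hpq
    exact h.isIncomparable_of_exponents 0 0 0 1 r 1 0 0 (by linarith) (by omega)
  · obtain ⟨r, rfl⟩ := Nat.exists_eq_add_of_le hpq
    exact h.isIncomparable_of_exponents r 0 0 1 0 1 0 0 (by linarith) (by omega)

theorem isIncomparable_komedaDeg₁ (h : KomedaRelations n p q a b c) (hq : 2 ≤ q) {j k : Fin 5}
    (hjk : j < k) : IsIncomparable n (komedaDeg₁ n p q a b c j) (komedaDeg₁ n p q a b c k) := by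
  obtain ⟨-, -, hp, -, ha, hb, hc, -, h₀, h₁, h₂⟩ := id h
  have h₁₂ := h.isIncomparable_mul_one_mul_two
  obtain ⟨q, rfl⟩ := Nat.exists_eq_add_of_le' (show 1 ≤ q by omega)
  obtain ⟨a, rfl⟩ := Nat.exists_eq_add_of_le' (show 1 ≤ a from ha)
  fin_cases j <;> fin_cases k <;> first | exact absurd hjk (by decide) | skip
  all_goals
    simp only [komedaDeg₁, Fin.zero_eta, Fin.mk_one, Fin.reduceFinMk, Matrix.cons_val]
  · exact h.isIncomparable_of_exponents (q + 2) 0 0 0 0 0 0 1 (by linarith) (by omega)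
  · exact h.isIncomparable_of_exponents (p + 1) 0 0 0 0 1 0 0 (by linarith) (by omega)
  · exact h.isIncomparable_of_exponents 0 0 1 0 0 0 0 1 (by linarith) (by omega)
  · exact h.isIncomparable_of_exponents 0 0 1 0 0 1 0 0 (by linarith) (by omega)
  · exact h₁₂
  · exact h.isIncomparable_of_exponents p 0 0 0 0 0 0 c (by linarith) (by omega)
  · exact h.isIncomparable_of_exponents 0 (a + 1) 0 0 0 0 0 c (by linarith) (by omega)
  · exact h.isIncomparable_of_exponents q 0 0 0 0 a b 0 (by linarith) (by omega)
  · exact h.isIncomparable_of_exponents 0 0 1 0 (p + 1) 0 0 0 (by linarith) (by omega)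
  · exact h.isIncomparable_of_exponents 0 0 0 1 0 1 0 0 (by linarith) (by omega)

theorem isIncomparable_komedaDeg₂ (h : KomedaRelations n p q a b c) (hc : 2 ≤ c) {j k : Fin 6}
    (hjk : j < k) : IsIncomparable n (komedaDeg₂ n p q a b c j) (komedaDeg₂ n p q a b c k) := by
  obtain ⟨-, -, hp, hq, ha, hb, -, -, h₀, h₁, h₂⟩ := id h
  have h₁₂ := h.isIncomparable_mul_one_mul_two
  obtain ⟨c, rfl⟩ := Nat.exists_eq_add_of_le' (show 1 ≤ c by omega)
  fin_cases j <;> fin_cases k <;> first | exact absurd hjk (by decide) | skip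
  all_goals
    simp only [komedaDeg₂, Fin.zero_eta, Fin.mk_one, Fin.reduceFinMk, Matrix.cons_val]
  · exact h.isIncomparable_of_exponents 1 0 0 0 0 0 0 1 (by linarith) (by omega)
  · exact h.isIncomparable_of_exponents 0 1 0 0 0 0 b 0 (by linarith) (by omega)
  · exact h.isIncomparable_of_exponents 0 0 1 0 0 0 0 1 (by linarith) (by omega)
  · exact h.isIncomparable_of_exponents 0 1 0 0 0 0 0 1 (by linarith) (by omega)
  · exact h.isIncomparable_of_exponents 0 0 1 0 0 a 0 0 (by linarith) (by omega)
  · exact h.isIncomparable_of_exponents p 0 0 0 0 0 0 c (by linarith) (by omega)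
  · exact h.isIncomparable_of_exponents 0 0 1 0 1 0 0 0 (by linarith) (by omega)
  · exact h.isIncomparable_of_exponents 0 1 0 0 1 0 0 0 (by linarith) (by omega)
  -- The two directions need different representations of the difference of the degrees.
  · exact ⟨h.ne_weight_add 0 1 1 0 (p + 1) 0 0 0 (by linarith) (by omega) (by omega),
      h.ne_weight_add 0 0 0 (c + 1) q 1 0 0 (by linarith) (by omega) (by omega)⟩
  · exact h.isIncomparable_of_exponents q 0 0 0 0 0 0 1 (by linarith) (by omega)
  · exact h.isIncomparable_of_exponents 0 0 b 0 0 0 0 1 (by linarith) (by omega)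
  · exact h₁₂.symm.congr (by linarith)
  · exact h.isIncomparable_of_exponents 0 1 0 0 0 0 1 0 (by linarith) (by omega)
  · exact h.isIncomparable_of_exponents 0 1 0 0 p 0 0 0 (by linarith) (by omega)
  · exact h.isIncomparable_of_exponents 0 0 1 0 p 0 0 0 (by linarith) (by omega)

theorem isIncomparable_komedaDeg₃ (h : KomedaRelations n p q a b c) :
    IsIncomparable n (komedaDeg₃ n p q a b c 0) (komedaDeg₃ n p q a b c 1) := by
  obtain ⟨-, -, hp, hq, ha, hb, hc, -, -, h₁, h₂⟩ := id h
  simp only [komedaDeg₃, Matrix.cons_val]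
  exact h.isIncomparable_of_exponents 1 0 0 0 0 0 0 c (by linarith) (by omega)

end KomedaRelations

theorem ne_weight_add_of_pairwise_isIncomparable {r : ℕ} {deg : Fin r → ℕ}
    (hdeg : ∀ {j k}, j < k → IsIncomparable n (deg j) (deg k)) {j k : Fin r} (hjk : j ≠ k)
    (u : Fin 4 →₀ ℕ) : deg j ≠ Finsupp.weight n u + deg k := by
  rcases lt_or_gt_of_ne hjk with hlt | hlt
  · exact (hdeg hlt).1 u
  · exact (hdeg hlt).2 u

namespace KomedaRelations

variable {K : Type*} [Field K]

theorem komedaResolution_stronglyIndispensable (h : KomedaRelations n p q a b c) (hc : 2 ≤ c)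
    (hq : 2 ≤ q) : (komedaResolution K h).StronglyIndispensable := by
  refine MinimalGradedResolution.stronglyIndispensable_of_deg h.pos _ fun i _ _ hjk => ?_
  match i with
  | 0 => exact absurd (Subsingleton.elim (α := Fin 1) _ _) hjk
  | 1 => exact ne_weight_add_of_pairwise_isIncomparable (h.isIncomparable_komedaDeg₁ hq) hjk
  | 2 => exact ne_weight_add_of_pairwise_isIncomparable (h.isIncomparable_komedaDeg₂ hc) hjk
  | 3 =>
    refine ne_weight_add_of_pairwise_isIncomparable (r := 2) (fun {j k} hlt => ?_) hjk
    obtain ⟨rfl, rfl⟩ : j = 0 ∧ k = 1 := by omega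
    exact h.isIncomparable_komedaDeg₃
  | _ + 4 => exact Fin.elim0 ‹_›

theorem not_stronglyIndispensable (h : KomedaRelations n p q a b c) (hcq : c = 1 ∨ q = 1)
    (F : MinimalGradedResolution K n) : ¬ F.StronglyIndispensable := by
  have : Subsingleton (Fin ((komedaResolution K h).rank 0)) :=
    inferInstanceAs (Subsingleton (Fin 1))
  obtain ⟨-, -, -, -, ha, -, -, -, h₀, h₁, h₂⟩ := id h
  rcases hcq with rfl | rfl
  · refine MinimalGradedResolution.not_stronglyIndispensable_of_deg (komedaResolution K h) 1
      (j := (1 : Fin 6)) (k := (2 : Fin 6)) (u := exponent p 0 0 0) (by decide : (1 : Fin 6) ≠ 2)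
      ?_ F
    rw [weight_exponent]
    change (a + 1) * n 1 + (b + 1) * n 2 = _ + ((p + q + 1) * n 0 + b * n 2)
    linarith
  · obtain ⟨a, rfl⟩ := Nat.exists_eq_add_of_le' (show 1 ≤ a from ha)
    refine MinimalGradedResolution.not_stronglyIndispensable_of_deg (komedaResolution K h) 0
      (j := (3 : Fin 5)) (k := (2 : Fin 5)) (u := exponent 0 a b 0) (by decide : (3 : Fin 5) ≠ 2)
      ?_ F
    rw [weight_exponent]
    change (c + 1) * n 3 = _ + (b + 1) * n 2
    linarith

theorem exists_stronglyIndispensable_iff (h : KomedaRelations n p q a b c) :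
    (∃ F : MinimalGradedResolution K n, F.StronglyIndispensable) ↔ 2 ≤ c ∧ 2 ≤ q := by
  refine ⟨fun ⟨F, hF⟩ => ?_, fun ⟨hc, hq⟩ =>
    ⟨komedaResolution K h, h.komedaResolution_stronglyIndispensable hc hq⟩⟩
  have hc := h.c_pos
  have hq := h.q_pos
  by_contra hcq
  exact h.not_stronglyIndispensable (by omega) F hF

end KomedaRelations

end Degrees

theorem IsMinimalGenerators.ne_mul {n : Fin 4 → ℕ} (hn : IsMinimalGenerators n) {i j : Fin 4}
    (hij : j ≠ i) (k : ℕ) : n i ≠ k * n j := fun h =>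
  hn.minimal i <| h ▸ smul_eq_mul k (n j) ▸
    AddSubmonoid.nsmul_mem _ (AddSubmonoid.subset_closure (Set.mem_image_of_mem n hij)) k

theorem IsMinimalGenerators.komedaRelations {n : Fin 4 → ℕ} (hn : IsMinimalGenerators n)
    {p q a b c : ℕ} (hp : 0 < p) (ha : 0 < a) (hb : 0 < b) (hc : 0 < c)
    (h₁ : n 0 = (a + 1) * (b + 1) * c + 1)
    (h₂ : n 1 = p * (b + 1) * (c + 1) + q * b + (b + 1))
    (h₃ : n 2 = (p + q) * (c + 1) + q * a * c + 1)
    (h₄ : n 3 = (p + q + 1) * (a + 1) * b + p * a + (a + 1)) :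
    KomedaRelations n p q a b c where
  pos := hn.pos
  gcd_eq_one := hn.gcd_eq_one
  p_pos := hp
  q_pos := by
    refine Nat.pos_of_ne_zero ?_
    rintro rfl
    exact hn.ne_mul (by decide : (2 : Fin 4) ≠ 1) (b + 1) (by rw [h₂, h₃]; ring)
  a_pos := ha
  b_pos := hb
  c_pos := hc
  n_zero := h₁
  rel₀ := by rw [h₁, h₃, h₄]; ring
  rel₁ := by rw [h₁, h₂, h₄]; ring
  rel₂ := by rw [h₁, h₂, h₃]; ring

theorem theorem2p6 {K : Type*} [Field K] (n : Fin 4 → ℕ) (hn : IsMinimalGenerators n)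
    (hS : IsPseudoSymmetric (numSemigroup n))
    (α₁ α₂ α₃ α₄ α₂₁ : ℤ)
    (hα₁ : 1 < α₁) (hα₂ : 1 < α₂) (hα₃ : 1 < α₃) (hα₄ : 1 < α₄)
    (hα₂₁ : 0 < α₂₁) (hα₂₁' : α₂₁ < α₁)
    (h₁ : (n 0 : ℤ) = α₂ * α₃ * (α₄ - 1) + 1)
    (h₂ : (n 1 : ℤ) = α₂₁ * α₃ * α₄ + (α₁ - α₂₁ - 1) * (α₃ - 1) + α₃)
    (h₃ : (n 2 : ℤ) = α₁ * α₄ + (α₁ - α₂₁ - 1) * (α₂ - 1) * (α₄ - 1) - α₄ + 1)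
    (h₄ : (n 3 : ℤ) = α₁ * α₂ * (α₃ - 1) + α₂₁ * (α₂ - 1) + α₂) :
    (∃ F : MinimalGradedResolution K n, F.StronglyIndispensable) ↔
      α₄ > 2 ∧ α₁ - α₂₁ > 2 := by
  obtain ⟨p, rfl⟩ := Int.eq_ofNat_of_zero_le hα₂₁.le
  obtain ⟨q, rfl⟩ : ∃ q : ℕ, α₁ = p + q + 1 := ⟨(α₁ - p - 1).toNat, by omega⟩
  obtain ⟨a, rfl⟩ : ∃ a : ℕ, α₂ = a + 1 := ⟨(α₂ - 1).toNat, by omega⟩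
  obtain ⟨b, rfl⟩ : ∃ b : ℕ, α₃ = b + 1 := ⟨(α₃ - 1).toNat, by omega⟩
  obtain ⟨c, rfl⟩ : ∃ c : ℕ, α₄ = c + 1 := ⟨(α₄ - 1).toNat, by omega⟩
  have h : KomedaRelations n p q a b c := hn.komedaRelations (by omega) (by omega) (by omega)
    (by omega) (by zify; rw [h₁]; ring) (by zify; rw [h₂]; ring) (by zify; rw [h₃]; ring)
    (by zify; rw [h₄]; ring)
  rw [h.exists_stronglyIndispensable_iff]
  omega
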